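/- A (rational) mould over $\mathbb{Q}$ is a family $A=(A_r)_{r\ge 0}$ with $A_r\in\mathbb{Q}(u_1,\dots,u_r)$; write $A(w_1,\dots,w_r)=A_r(w_1,\dots,w_r)$. Let $\mathrm{ARI}$ be the space of moulds with $A(\varnothing)=0$. For $1\le r$ and a factorization $(u_1,\dots,u_r)=abc$ with $a=(u_1,\dots,u_k)$, $b=(u_{k+1},\dots,u_\ell)$, $c=(u_{\ell+1},\dots,u_r)$, put $a\lceil c=(u_1,\dots,u_k,\,u_{k+1}+\cdots+u_{\ell+1},\,u_{\ell+2},\dots,u_r)$ if $c\ne\varnothing$ and $a\rceil c=(u_1,\dots,u_{k-1},\,u_k+\cdots+u_\ell,\,u_{\ell+1},\dots,u_r)$ if $a\neq\varnothing$. Define $$(\mathrm{arit}(B)\cdot A)(u_1,\dots,u_r)=\sum_{0\le k<\ell<r}A(a\lceil c)B(b)-\sum_{1\le k<\ell\le r}A(a\rceil c)B(b),$$ $$\mathrm{mu}(A,B)(u_1,\dots,u_r)=\sum_{i=0}^rA(u_1,\dots,u_i)B(u_{i+1},\dots,u_r),\qquad \mathrm{lu}(A,B)=\mathrm{mu}(A,B)-\mathrm{mu}(B,A),$$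 $$\mathrm{ari}(A,B)=\mathrm{arit}(B)\cdot A-\mathrm{arit}(A)\cdot B+\mathrm{lu}(A,B).$$ A mould $A$ is alternal if for all $r>1$ and $1\le s<r$ one has $\sum_\sigma A(u_{\sigma^{-1}(1)},\dots,u_{\sigma^{-1}(r)})=0$, where $\sigma$ runs over the permutations of $\{1,\dots,r\}$ with $\sigma(1)<\cdots<\sigma(s)$ and $\sigma(s+1)<\cdots<\sigma(r)$. Let $\mathrm{swap}(A)(v_1,\dots,v_r)=A(v_r,v_{r-1}-v_r,\dots,v_1-v_2)$; $A$ is bialternal if $A$ and $\mathrm{swap}(A)$ are both alternal. Let $\mathrm{ARI}_{\underline{al}/\underline{al}}$ be the set of bialternal moulds in $\mathrm{ARI}$ whose depth-$1$ part $A_1(u_1)$ is an even function, and let $\mathrm{ARI}^{\mathrm{sing}}$ be the set of moulds $A\in\mathrm{ARI}$ such that $u_1\cdots u_r(u_1+\cdots+u_r)A_r(u_1,\dots,u_r)$ is a polynomial for every $r\ge1$. **Theorem.** $\mathrm{ARI}^{\mathrm{sing}}_{\underline{al}/\underline{al}}=\mathrm{ARI}_{\underline{al}/\underline{al}}\cap\mathrm{ARI}^{\mathrm{sing}}$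 is closed under the ari-bracket, and it is a Lie algebra over $\mathbb{Q}$ under this bracket. -/

import Mathlib

/-- The field `ℚ(u₁, …, u_r)` of rational functions in `r` commuting variables. -/
abbrev RatFun (r : ℕ) : Type := FractionRing (MvPolynomial (Fin r) ℚ)

/-- The value of a rational function `f ∈ ℚ(u₁, …, u_r)` at `x = (x₁, …, x_r)` with entries in a
field `K` of characteristic zero, computed from the reduced fraction of `f`. In this development
it is only used at tuples `x` that are linearly independent linear forms in variables
`u₁, …, u_n` (with `K = ℚ(u₁, …, u_n)`), at which no denominator vanishes, so there it is the usual
substitution of variables. -/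
noncomputable def RatFun.eval {r : ℕ} {K : Type*} [Field K] [Algebra ℚ K]
    (f : RatFun r) (x : Fin r → K) : K :=
  MvPolynomial.aeval x (IsFractionRing.num (MvPolynomial (Fin r) ℚ) f) /
    MvPolynomial.aeval x (IsFractionRing.den (MvPolynomial (Fin r) ℚ) f : MvPolynomial (Fin r) ℚ)

/-- The value does not depend on the fraction `p / q` that represents the rational function, as
long as `q` does not vanish at `x`. -/
theorem RatFun.eval_div {r : ℕ} {K : Type*} [Field K] [Algebra ℚ K]
    (p q : MvPolynomial (Fin r) ℚ) (x : Fin r → K) (hq : MvPolynomial.aeval x q ≠ 0) :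
    RatFun.eval (algebraMap (MvPolynomial (Fin r) ℚ) (RatFun r) p /
      algebraMap (MvPolynomial (Fin r) ℚ) (RatFun r) q) x =
      MvPolynomial.aeval x p / MvPolynomial.aeval x q := by
  set f : RatFun r := algebraMap (MvPolynomial (Fin r) ℚ) (RatFun r) p /
    algebraMap (MvPolynomial (Fin r) ℚ) (RatFun r) q with hf
  set n := IsFractionRing.num (MvPolynomial (Fin r) ℚ) f with hn
  set d := (IsFractionRing.den (MvPolynomial (Fin r) ℚ) f : MvPolynomial (Fin r) ℚ) with hd
  have inj := IsFractionRing.injective (MvPolynomial (Fin r) ℚ) (RatFun r)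
  have hd0 : d ≠ 0 := nonZeroDivisors.ne_zero (IsFractionRing.den _ f).2
  have hq0 : q ≠ 0 := by
    rintro rfl
    simp at hq
  have key : n * q = p * d := by
    apply inj
    have h := IsFractionRing.mk'_num_den' (MvPolynomial (Fin r) ℚ) f
    rw [← hn, ← hd, hf, div_eq_div_iff
      ((map_ne_zero_iff _ inj).2 hd0) ((map_ne_zero_iff _ inj).2 hq0)] at h
    simpa only [map_mul] using h
  have hrel : IsRelPrime n d := IsFractionRing.num_den_reduced _ f
  have hdvd : d ∣ q := hrel.symm.dvd_of_dvd_mul_left ⟨p, by rw [key, mul_comm]⟩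
  have hdx : MvPolynomial.aeval x d ≠ 0 := by
    obtain ⟨c, hc⟩ := hdvd
    intro h0
    apply hq
    rw [hc, map_mul, h0, zero_mul]
  change MvPolynomial.aeval x n / MvPolynomial.aeval x d = _
  rw [div_eq_div_iff hdx hq, ← map_mul, ← map_mul, key]

/-- Rational-function valued moulds over `ℚ`: families `(A_r)_{r ≥ 0}` with
`A_r ∈ ℚ(u₁, …, u_r)`. The same type serves for moulds in the variables `v_i`. -/
abbrev Mould : Type := (r : ℕ) → RatFun r

namespace Mould

/-- `A(w₁, …, w_r) = A_r(w₁, …, w_r)` for a word `w = (w₁, …, w_r)` in a field. -/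
noncomputable def evalWord {K : Type*} [Field K] [Algebra ℚ K] (A : Mould) (w : List K) : K :=
  RatFun.eval (A w.length) w.get

/-- The variable `u_{i+1}` of `ℚ(u₁, …, u_r)`. -/
noncomputable def var {r : ℕ} (i : Fin r) : RatFun r :=
  algebraMap (MvPolynomial (Fin r) ℚ) (RatFun r) (MvPolynomial.X i)

/-- The word `(u₁, …, u_r)`. -/
noncomputable def vars (r : ℕ) : List (RatFun r) := List.ofFn var

/-- The word `a⌈c` with respect to a decomposition `w = abc`: the sum of the letters of `b` is
added to the first letter of `c` (only used for `c ≠ ∅`). -/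
def flexR {K : Type*} [Field K] (a b : List K) : List K → List K
  | [] => a
  | x :: c => a ++ (b.sum + x) :: c

/-- The word `a⌉c` with respect to a decomposition `w = abc`: the sum of the letters of `b` is
added to the last letter of `a` (only used for `a ≠ ∅`). -/
def flexL {K : Type*} [Field K] (a b c : List K) : List K :=
  a.dropLast ++ (a.getLastD 0 + b.sum) :: c

/-- `(arit(B)·A)(u₁, …, u_r) = ∑_{0 ≤ k < l < r} A(a⌈c) B(b) - ∑_{1 ≤ k < l ≤ r} A(a⌉c) B(b)`, where
`a = (u₁, …, u_k)`, `b = (u_{k+1}, …, u_l)`, `c = (u_{l+1}, …, u_r)`. -/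
noncomputable def arit (B A : Mould) : Mould := fun r =>
  (∑ k ∈ Finset.range r, ∑ l ∈ Finset.Ioo k r,
      A.evalWord (flexR ((vars r).take k) (((vars r).take l).drop k) ((vars r).drop l)) *
        B.evalWord (((vars r).take l).drop k)) -
    ∑ k ∈ Finset.Icc 1 r, ∑ l ∈ Finset.Ioc k r,
      A.evalWord (flexL ((vars r).take k) (((vars r).take l).drop k) ((vars r).drop l)) *
        B.evalWord (((vars r).take l).drop k)

/-- `mu(A, B)(u₁, …, u_r) = ∑_{i=0}^{r} A(u₁, …, u_i) B(u_{i+1}, …, u_r)`. -/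
noncomputable def mu (A B : Mould) : Mould := fun r =>
  ∑ i ∈ Finset.range (r + 1), A.evalWord ((vars r).take i) * B.evalWord ((vars r).drop i)

/-- `lu(A, B) = mu(A, B) - mu(B, A)`. -/
noncomputable def lu (A B : Mould) : Mould := mu A B - mu B A

/-- The ari-bracket `ari(A, B) = arit(B)·A - arit(A)·B + lu(A, B)`. -/
noncomputable def ari (A B : Mould) : Mould := arit B A - arit A B + lu A B

/-- `swap(A)(v₁, …, v_r) = A(v_r, v_{r-1} - v_r, …, v₁ - v₂)`. -/
noncomputable def swap (A : Mould) : Mould := fun r =>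
  RatFun.eval (A r) fun i =>
    if h : i.val = 0 then var i.rev else var i.rev - var (⟨r - i.val, by omega⟩ : Fin r)

/-- `A` is alternal: for all `r > 1` and `1 ≤ s < r`, the sum of
`A(u_{σ⁻¹(1)}, …, u_{σ⁻¹(r)})` over the permutations `σ` of `{1, …, r}` with
`σ(1) < ⋯ < σ(s)` and `σ(s+1) < ⋯ < σ(r)` vanishes. -/
def IsAlternal (A : Mould) : Prop :=
  ∀ r s : ℕ, 1 ≤ s → s < r →
    ∑ σ : Equiv.Perm (Fin r) with
        (∀ i j : Fin r, i < j → j.val < s → σ i < σ j) ∧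
        (∀ i j : Fin r, i < j → s ≤ i.val → σ i < σ j),
      RatFun.eval (A r) (fun i => var (σ.symm i)) = 0

/-- The underlying space of `ARI`: moulds with `A(∅) = 0`. -/
def ARI : Set Mould := {A | A 0 = 0}

/-- Moulds in `ARI` that are bialternal (`A` and `swap(A)` are alternal) and whose depth 1 part is
an even function. -/
def ARIalal : Set Mould :=
  {A | A ∈ ARI ∧ A.IsAlternal ∧ (swap A).IsAlternal ∧
    RatFun.eval (A 1) (fun i => -var i) = A 1}

/-- `Δ_r(u₁, …, u_r) = u₁ ⋯ u_r (u₁ + ⋯ + u_r)`. -/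
noncomputable def Δ (r : ℕ) : RatFun r := (∏ i, var i) * ∑ i, var i

/-- Moulds in `ARI` such that `Δ_r A_r` is a polynomial for each `r ≥ 1`. -/
def ARIsing : Set Mould :=
  {A | A ∈ ARI ∧ ∀ r : ℕ, 1 ≤ r → ∃ p : MvPolynomial (Fin r) ℚ,
    Δ r * A r = algebraMap (MvPolynomial (Fin r) ℚ) (RatFun r) p}

end Mould

/-! A mould acts on words in any field extension of `ℚ`. On generic words, whose letters are
linearly independent linear forms, evaluation is a field homomorphism, so identities between
moulds can be checked for functions on words, where the variables of `ari` become letters of a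
word.

Alternality: in the variables `u` as in the variables `v`, the operator `arit B` absorbs a factor
of the word into a neighbouring letter, with weight a value of `B`. Under a sum over shuffles, the
absorbed factor and its neighbour are either shuffled together or separated, and the separated
terms of the absorptions from the left and from the right cancel. For the swap this applies once
the bracket has been rewritten in differences of consecutive variables, which uses
push-invariance, a consequence of bialternality and of evenness in depth one.

Jacobi identity: on functions on words, `arit B` contracts a factor `f` to the letter `f.sum`,
with weight the difference of the values of `B` at `f` without its last and without its first
letter. Two successive contractions are nested or disjoint, and disjoint ones commute.

Poles: the bracket can acquire poles only along sums of factors. The pole along `f.sum` of the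
contraction of `f` cancels because push-invariance moves both weights to words that differ only in
the first letter, by `f.sum`. The pole along `b.sum` of the absorptions of `b` cancels between the
two neighbours of `b`, or against a term of `mu` when `b` is a prefix or a suffix of the word,
since replacing a letter `z` by `z + b.sum` changes a polynomial numerator by a multiple of
`b.sum`. -/

namespace WordFun

/-! ### Sums over factorizations and shuffles -/

section Sums

variable {V K : Type*} [AddCommMonoid K]

/-- The sum of `F a b` over the factorizations `w = ab` of a word. -/
def splitSum (F : List V → List V → K) : List V → K
  | [] => F [] []
  | z :: w => F [] (z :: w) + splitSum (fun a b => F (z :: a) b) w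

/-- The sum of `F a z c` over the factorizations `w = azc` of a word around one of its letters. -/
def pivotSum (F : List V → V → List V → K) : List V → K
  | [] => 0
  | z :: w => F [] z w + pivotSum (fun a y c => F (z :: a) y c) w

/-- The sum of `F w` over the shuffles `w` of two words, with multiplicity. -/
def shuffleSum (F : List V → K) : List V → List V → K
  | [], y => F y
  | a :: x, [] => F (a :: x)
  | a :: x, b :: y =>
    shuffleSum (fun w => F (a :: w)) x (b :: y) + shuffleSum (fun w => F (b :: w)) (a :: x) y
termination_by x y => x.length + y.length

@[simp] theorem splitSum_nil (F : List V → List V → K) : splitSum F [] = F [] [] := rfl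

theorem splitSum_cons (F : List V → List V → K) (z : V) (w : List V) :
    splitSum F (z :: w) = F [] (z :: w) + splitSum (fun a b => F (z :: a) b) w := rfl

@[simp] theorem pivotSum_nil (F : List V → V → List V → K) : pivotSum F [] = 0 := rfl

theorem pivotSum_cons (F : List V → V → List V → K) (z : V) (w : List V) :
    pivotSum F (z :: w) = F [] z w + pivotSum (fun a y c => F (z :: a) y c) w := rfl

@[simp] theorem shuffleSum_nil_left (F : List V → K) (y : List V) : shuffleSum F [] y = F y := by
  rw [shuffleSum]

@[simp] theorem shuffleSum_nil_right (F : List V → K) (x : List V) : shuffleSum F x [] = F x := by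
  cases x <;> rw [shuffleSum]

theorem shuffleSum_cons_cons (F : List V → K) (a b : V) (x y : List V) :
    shuffleSum F (a :: x) (b :: y) =
      shuffleSum (fun w => F (a :: w)) x (b :: y) +
        shuffleSum (fun w => F (b :: w)) (a :: x) y := by
  rw [shuffleSum]

theorem shuffle_induction {P : List V → List V → Prop} (nil_left : ∀ y, P [] y)
    (nil_right : ∀ x, P x [])
    (cons_cons : ∀ a x b y, P x (b :: y) → P (a :: x) y → P (a :: x) (b :: y))
    (x y : List V) : P x y := by
  induction x generalizing y with
  | nil => exact nil_left y
  | cons a x ihx =>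
    induction y with
    | nil => exact nil_right _
    | cons b y ihy => exact cons_cons a x b y (ihx _) ihy

theorem splitSum_congr {F G : List V → List V → K} {w : List V}
    (h : ∀ a b, w = a ++ b → F a b = G a b) : splitSum F w = splitSum G w := by
  induction w generalizing F G with
  | nil => exact h _ _ rfl
  | cons z w ih =>
    rw [splitSum_cons, splitSum_cons, h [] _ rfl, ih]
    rintro a b rfl
    exact h _ _ rfl

theorem pivotSum_congr {F G : List V → V → List V → K} {w : List V}
    (h : ∀ a z c, w = a ++ z :: c → F a z c = G a z c) : pivotSum F w = pivotSum G w := by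
  induction w generalizing F G with
  | nil => rfl
  | cons z w ih =>
    rw [pivotSum_cons, pivotSum_cons, h [] _ _ rfl, ih]
    rintro a y c rfl
    exact h _ _ _ rfl

theorem shuffleSum_congr {F G : List V → K} {x y : List V}
    (h : ∀ w, w.Perm (x ++ y) → F w = G w) : shuffleSum F x y = shuffleSum G x y := by
  induction x, y using shuffle_induction generalizing F G with
  | nil_left y => simpa using h y (by simp)
  | nil_right x => simpa using h x (by simp)
  | cons_cons a x b y ihx ihy =>
    rw [shuffleSum_cons_cons, shuffleSum_cons_cons,
      ihx fun w hw => h _ (hw.cons a), ihy fun w hw => h _ ((hw.cons b).trans ?_)]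
    exact List.perm_middle.symm

theorem map_splitSum {M : Type*} [AddCommMonoid M] (Φ : K →+ M) (F : List V → List V → K)
    (w : List V) : Φ (splitSum F w) = splitSum (fun a b => Φ (F a b)) w := by
  induction w generalizing F with
  | nil => rfl
  | cons z w ih => rw [splitSum_cons, splitSum_cons, map_add, ih]

theorem map_pivotSum {M : Type*} [AddCommMonoid M] (Φ : K →+ M) (F : List V → V → List V → K)
    (w : List V) : Φ (pivotSum F w) = pivotSum (fun a z c => Φ (F a z c)) w := by
  induction w generalizing F with
  | nil => exact map_zero Φ
  | cons z w ih => rw [pivotSum_cons, pivotSum_cons, map_add, ih]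

theorem map_shuffleSum {M : Type*} [AddCommMonoid M] (Φ : K →+ M) (F : List V → K)
    (x y : List V) : Φ (shuffleSum F x y) = shuffleSum (fun w => Φ (F w)) x y := by
  induction x, y using shuffle_induction generalizing F with
  | nil_left y => simp
  | nil_right x => simp
  | cons_cons a x b y ihx ihy =>
    rw [shuffleSum_cons_cons, shuffleSum_cons_cons, map_add, ihx, ihy]

theorem splitSum_add (F G : List V → List V → K) (w : List V) :
    splitSum (fun a b => F a b + G a b) w = splitSum F w + splitSum G w := by
  induction w generalizing F G with
  | nil => rfl
  | cons z w ih => simp only [splitSum_cons, ih]; abel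

theorem pivotSum_add (F G : List V → V → List V → K) (w : List V) :
    pivotSum (fun a z c => F a z c + G a z c) w = pivotSum F w + pivotSum G w := by
  induction w generalizing F G with
  | nil => simp
  | cons z w ih => simp only [pivotSum_cons, ih]; abel

theorem shuffleSum_add (F G : List V → K) (x y : List V) :
    shuffleSum (fun w => F w + G w) x y = shuffleSum F x y + shuffleSum G x y := by
  induction x, y using shuffle_induction generalizing F G with
  | nil_left y => simp
  | nil_right x => simp
  | cons_cons a x b y ihx ihy => simp only [shuffleSum_cons_cons, ihx, ihy]; abel

@[simp] theorem splitSum_zero (w : List V) : splitSum (fun _ _ => (0 : K)) w = 0 := by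
  induction w with
  | nil => rfl
  | cons z w ih => rw [splitSum_cons, ih, add_zero]

@[simp] theorem pivotSum_zero (w : List V) : pivotSum (fun _ _ _ => (0 : K)) w = 0 := by
  induction w with
  | nil => rfl
  | cons z w ih => rw [pivotSum_cons, ih, add_zero]

@[simp] theorem shuffleSum_zero (x y : List V) : shuffleSum (fun _ => (0 : K)) x y = 0 :=
  (map_shuffleSum (0 : K →+ K) (fun _ => 0) x y).symm

theorem splitSum_comm (F : List V → List V → List V → List V → K) (x y : List V) :
    splitSum (fun a b => splitSum (fun c d => F a b c d) y) x =
      splitSum (fun c d => splitSum (fun a b => F a b c d) x) y := by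
  induction x generalizing F with
  | nil => rfl
  | cons z x ih => simp only [splitSum_cons, splitSum_add, ih]

theorem shuffleSum_splitSum_comm (F : List V → List V → List V → K) (x y w : List V) :
    shuffleSum (fun v => splitSum (fun a b => F a b v) w) x y =
      splitSum (fun a b => shuffleSum (F a b) x y) w := by
  induction w generalizing F with
  | nil => rfl
  | cons z w ih => simp only [splitSum_cons, shuffleSum_add, ih]

theorem shuffleSum_comm (F : List V → K) (x y : List V) :
    shuffleSum F x y = shuffleSum F y x := by
  induction x, y using shuffle_induction generalizing F with
  | nil_left y => simp
  | nil_right x => simp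
  | cons_cons a x b y ihx ihy =>
    rw [shuffleSum_cons_cons, shuffleSum_cons_cons, ihx, ihy, add_comm]

theorem splitSum_eq_nil_left_add (F : List V → List V → K) (w : List V) :
    splitSum F w = F [] w + pivotSum (fun a z c => F (a ++ [z]) c) w := by
  induction w generalizing F with
  | nil => simp
  | cons z w ih => rw [splitSum_cons, pivotSum_cons, ih]; rfl

theorem splitSum_eq_nil_right_add (F : List V → List V → K) (w : List V) :
    splitSum F w = F w [] + pivotSum (fun a z c => F a (z :: c)) w := by
  induction w generalizing F with
  | nil => simp
  | cons z w ih => rw [splitSum_cons, pivotSum_cons, ih]; abel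

theorem splitSum_concat (F : List V → List V → K) (w : List V) (y : V) :
    splitSum F (w ++ [y]) = splitSum (fun a b => F a (b ++ [y])) w + F (w ++ [y]) [] := by
  induction w generalizing F with
  | nil => simp [splitSum_cons]
  | cons z w ih => simp only [List.cons_append, splitSum_cons, ih]; abel

theorem splitSum_append_cons (F : List V → List V → K) (a c : List V) (z : V) :
    splitSum F (a ++ z :: c) = splitSum (fun a₁ a₂ => F a₁ (a₂ ++ z :: c)) a +
      splitSum (fun c₁ c₂ => F (a ++ z :: c₁) c₂) c := by
  induction a generalizing F with
  | nil => rfl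
  | cons y a ih => simp only [List.cons_append, splitSum_cons, ih, add_assoc]

theorem splitSum_assoc (F : List V → List V → List V → K) (w : List V) :
    splitSum (fun s c => splitSum (fun a b => F a b c) s) w =
      splitSum (fun a s => splitSum (fun b c => F a b c) s) w := by
  induction w generalizing F with
  | nil => rfl
  | cons z w ih => simp only [splitSum_cons, splitSum_nil, splitSum_add, ih, add_assoc]

theorem pivotSum_splitSum (F : List V → List V → V → List V → K) (w : List V) :
    pivotSum (fun s z c => splitSum (fun a b => F a b z c) s) w =
      splitSum (fun a t => pivotSum (fun b z c => F a b z c) t) w := by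
  induction w generalizing F with
  | nil => rfl
  | cons z w ih =>
    simp only [splitSum_cons, splitSum_nil, pivotSum_cons, pivotSum_add, ih, add_assoc]

theorem pivotSum_splitSum_concat (F : List V → List V → List V → K)
    (hF : ∀ a c, F a [] c = 0) (w : List V) :
    pivotSum (fun s z c => splitSum (fun a b => F a (b ++ [z]) c) s) w =
      splitSum (fun a t => splitSum (fun f c => F a f c) t) w := by
  rw [pivotSum_splitSum]
  refine splitSum_congr fun a t _ => ?_
  rw [splitSum_eq_nil_left_add, hF, zero_add]

theorem pivotSum_splitSum_cons (F : List V → List V → List V → K)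
    (hF : ∀ a c, F a [] c = 0) (w : List V) :
    pivotSum (fun a z s => splitSum (fun b c => F a (z :: b) c) s) w =
      splitSum (fun a t => splitSum (fun f c => F a f c) t) w := by
  rw [splitSum_eq_nil_right_add]
  simp only [splitSum_nil, hF, splitSum_cons, zero_add]

theorem shuffleSum_splitSum (F : List V → List V → K) (x y : List V) :
    shuffleSum (fun w => splitSum F w) x y =
      splitSum (fun x₁ x₂ => splitSum (fun y₁ y₂ =>
        shuffleSum (fun a => shuffleSum (fun b => F a b) x₂ y₂) x₁ y₁) y) x := by
  induction x, y using shuffle_induction generalizing F with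
  | nil_left y => simp
  | nil_right x => simp
  | cons_cons a x b y ihx ihy =>
    simp only [shuffleSum_cons_cons, splitSum_cons, shuffleSum_add, ihx, ihy,
      shuffleSum_nil_left, shuffleSum_nil_right, splitSum_add]
    abel

/-- The part of the sum of `pivotSum F` over the shuffles of `x` and `y` in which the
distinguished letter comes from `x`. -/
def pivotShuffleSum (F : List V → V → List V → K) (x y : List V) : K :=
  pivotSum (fun x₁ z x₂ => splitSum (fun y₁ y₂ =>
    shuffleSum (fun a => shuffleSum (fun c => F a z c) x₂ y₂) x₁ y₁) y) x

theorem shuffleSum_pivotSum (F : List V → V → List V → K) (x y : List V) :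
    shuffleSum (fun w => pivotSum F w) x y = pivotShuffleSum F x y + pivotShuffleSum F y x := by
  induction x, y using shuffle_induction generalizing F with
  | nil_left y => simp [pivotShuffleSum]
  | nil_right x => simp [pivotShuffleSum]
  | cons_cons a x b y ihx ihy =>
    simp only [pivotShuffleSum] at ihx ihy ⊢
    simp only [shuffleSum_cons_cons, pivotSum_cons, shuffleSum_add, ihx, ihy, splitSum_cons,
      shuffleSum_nil_left, shuffleSum_nil_right, splitSum_add, pivotSum_add,
      shuffleSum_comm _ y (a :: x)]
    abel

theorem shuffleSum_append_cons (F : List V → K) (x₁ x₂ y : List V) (z : V) :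
    shuffleSum F (x₁ ++ z :: x₂) y =
      splitSum (fun y₁ y₂ =>
        shuffleSum (fun a => shuffleSum (fun c => F (a ++ z :: c)) x₂ y₂) x₁ y₁) y := by
  induction x₁, y using shuffle_induction generalizing F with
  | nil_left y =>
    induction y generalizing F with
    | nil => simp
    | cons b y ih =>
      simp only [List.nil_append] at ih ⊢
      rw [shuffleSum_cons_cons, ih, splitSum_cons]
      simp
  | nil_right x => simp
  | cons_cons a x b y ihx ihy =>
    rw [List.cons_append, shuffleSum_cons_cons, ihx, ← List.cons_append, ihy]
    simp only [shuffleSum_cons_cons, splitSum_cons, shuffleSum_nil_right, splitSum_add,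
      List.cons_append]
    abel

theorem shuffleSum_concat_concat (F : List V → K) (x y : List V) (a b : V) :
    shuffleSum F (x ++ [a]) (y ++ [b]) =
      shuffleSum (fun w => F (w ++ [a])) x (y ++ [b]) +
        shuffleSum (fun w => F (w ++ [b])) (x ++ [a]) y := by
  rw [shuffleSum_append_cons, splitSum_concat]
  simp [shuffleSum_append_cons, add_comm]

theorem shuffleSum_map {W : Type*} (g : V → W) (F : List W → K) (x y : List V) :
    shuffleSum F (x.map g) (y.map g) = shuffleSum (fun w => F (w.map g)) x y := by
  induction x, y using shuffle_induction generalizing F with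
  | nil_left y => simp
  | nil_right x => simp
  | cons_cons a x b y ihx ihy =>
    simp only [List.map_cons] at ihx ihy ⊢
    rw [shuffleSum_cons_cons, shuffleSum_cons_cons, ihx, ihy]
    rfl

theorem shuffleSum_reverse (F : List V → K) (x y : List V) :
    shuffleSum F x.reverse y.reverse = shuffleSum (fun w => F w.reverse) x y := by
  induction x, y using shuffle_induction generalizing F with
  | nil_left y => simp
  | nil_right x => simp
  | cons_cons a x b y ihx ihy =>
    simp only [List.reverse_cons] at ihx ihy ⊢
    rw [shuffleSum_concat_concat, shuffleSum_cons_cons, ihx, ihy]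
    simp

theorem splitSum_eq_sum_range (F : List V → List V → K) (w : List V) :
    splitSum F w = ∑ i ∈ Finset.range (w.length + 1), F (w.take i) (w.drop i) := by
  induction w generalizing F with
  | nil => simp
  | cons z w ih =>
    rw [splitSum_cons, ih, List.length_cons, Finset.sum_range_succ' _ (w.length + 1)]
    simp [add_comm]

end Sums

section SumsInRing

variable {V K : Type*} [CommRing K]

theorem splitSum_mul_left (k : K) (F : List V → List V → K) (w : List V) :
    splitSum (fun a b => k * F a b) w = k * splitSum F w :=
  (map_splitSum (AddMonoidHom.mulLeft k) F w).symm

theorem splitSum_mul_right (F : List V → List V → K) (k : K) (w : List V) :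
    splitSum (fun a b => F a b * k) w = splitSum F w * k :=
  (map_splitSum (AddMonoidHom.mulRight k) F w).symm

theorem pivotSum_mul_left (k : K) (F : List V → V → List V → K) (w : List V) :
    pivotSum (fun a z c => k * F a z c) w = k * pivotSum F w :=
  (map_pivotSum (AddMonoidHom.mulLeft k) F w).symm

theorem shuffleSum_mul_left (k : K) (F : List V → K) (x y : List V) :
    shuffleSum (fun w => k * F w) x y = k * shuffleSum F x y :=
  (map_shuffleSum (AddMonoidHom.mulLeft k) F x y).symm

theorem shuffleSum_mul_right (F : List V → K) (k : K) (x y : List V) :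
    shuffleSum (fun w => F w * k) x y = shuffleSum F x y * k :=
  (map_shuffleSum (AddMonoidHom.mulRight k) F x y).symm

theorem splitSum_sub (F G : List V → List V → K) (w : List V) :
    splitSum (fun a b => F a b - G a b) w = splitSum F w - splitSum G w := by
  induction w generalizing F G with
  | nil => rfl
  | cons z w ih => simp only [splitSum_cons, ih]; abel

theorem pivotSum_sub (F G : List V → V → List V → K) (w : List V) :
    pivotSum (fun a z c => F a z c - G a z c) w = pivotSum F w - pivotSum G w := by
  induction w generalizing F G with
  | nil => simp
  | cons z w ih => simp only [pivotSum_cons, ih]; abel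

theorem shuffleSum_sub (F G : List V → K) (x y : List V) :
    shuffleSum (fun w => F w - G w) x y = shuffleSum F x y - shuffleSum G x y := by
  induction x, y using shuffle_induction generalizing F G with
  | nil_left y => simp
  | nil_right x => simp
  | cons_cons a x b y ihx ihy => simp only [shuffleSum_cons_cons, ihx, ihy]; abel

/-- The counit of the algebra of words, i.e. the indicator function of the empty word. -/
def counit (w : List V) : K := if w.isEmpty then 1 else 0

@[simp] theorem counit_nil : counit ([] : List V) = (1 : K) := rfl

@[simp] theorem counit_cons (z : V) (w : List V) : counit (z :: w) = (0 : K) := rfl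

theorem splitSum_mul_counit_left (F : List V → List V → K) (w : List V) :
    splitSum (fun a b => F a b * counit a) w = F [] w := by
  simp [splitSum_eq_nil_left_add, counit]

theorem splitSum_mul_counit_right (F : List V → List V → K) (w : List V) :
    splitSum (fun a b => F a b * counit b) w = F w [] := by
  simp [splitSum_eq_nil_right_add]

end SumsInRing

section Product

variable {V K : Type*} [CommRing K]

/-- The product `mu` of functions on words, dual to deconcatenation, as a bilinear map. -/
def mu : (List V → K) →ₗ[K] (List V → K) →ₗ[K] List V → K :=
  LinearMap.mk₂ K (fun A B w => splitSum (fun a b => A a * B b) w)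
    (fun A A' B => by funext w; simp only [Pi.add_apply, add_mul, splitSum_add])
    (fun k A B => by funext w; simp only [Pi.smul_apply, smul_eq_mul, mul_assoc, splitSum_mul_left])
    (fun A B B' => by funext w; simp only [Pi.add_apply, mul_add, splitSum_add])
    (fun k A B => by
      funext w; simp only [Pi.smul_apply, smul_eq_mul, mul_left_comm _ k, splitSum_mul_left])

theorem mu_apply (A B : List V → K) (w : List V) :
    mu A B w = splitSum (fun a b => A a * B b) w := rfl

theorem mu_assoc (A B C : List V → K) : mu (mu A B) C = mu A (mu B C) := by
  funext w
  simp only [mu_apply, ← splitSum_mul_right, ← splitSum_mul_left, splitSum_assoc, mul_assoc]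

end Product

/-! ### Alternality of products and of absorptions -/

section Alternal

variable {V K : Type*} [CommRing K]

/-- A function on words is alternal if it vanishes on the empty word and its sum over the
shuffles of any two nonempty words is zero. -/
structure IsAlternal (A : List V → K) : Prop where
  nil : A [] = 0
  shuffleSum_eq_zero : ∀ x y : List V, x ≠ [] → y ≠ [] → shuffleSum A x y = 0

namespace IsAlternal

theorem zero : IsAlternal (0 : List V → K) where
  nil := rfl
  shuffleSum_eq_zero x y _ _ := shuffleSum_zero x y

theorem shuffleSum_eq {A : List V → K} (hA : IsAlternal A) (x y : List V) :
    shuffleSum A x y = A y * counit x + A x * counit y := by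
  cases x with
  | nil => cases y <;> simp [hA.nil]
  | cons a x =>
    cases y with
    | nil => simp
    | cons b y => simp [hA.shuffleSum_eq_zero]

theorem add {A B : List V → K} (hA : IsAlternal A) (hB : IsAlternal B) : IsAlternal (A + B) where
  nil := by simp [hA.nil, hB.nil]
  shuffleSum_eq_zero x y hx hy := (shuffleSum_add A B x y).trans <| by
    rw [hA.shuffleSum_eq_zero x y hx hy, hB.shuffleSum_eq_zero x y hx hy, add_zero]

theorem sub {A B : List V → K} (hA : IsAlternal A) (hB : IsAlternal B) : IsAlternal (A - B) where
  nil := by simp [hA.nil, hB.nil]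
  shuffleSum_eq_zero x y hx hy := (shuffleSum_sub A B x y).trans <| by
    rw [hA.shuffleSum_eq_zero x y hx hy, hB.shuffleSum_eq_zero x y hx hy, sub_zero]

theorem smul (k : K) {A : List V → K} (hA : IsAlternal A) : IsAlternal (k • A) where
  nil := by simp [hA.nil]
  shuffleSum_eq_zero x y hx hy := (shuffleSum_mul_left k A x y).trans <| by
    rw [hA.shuffleSum_eq_zero x y hx hy, mul_zero]

theorem comp_map {W : Type*} {A : List W → K} (hA : IsAlternal A) (g : V → W) :
    IsAlternal fun w => A (w.map g) where
  nil := hA.nil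
  shuffleSum_eq_zero x y hx hy := by
    rw [← shuffleSum_map, hA.shuffleSum_eq_zero _ _ (by simpa using hx) (by simpa using hy)]

theorem comp_reverse {A : List V → K} (hA : IsAlternal A) : IsAlternal fun w => A w.reverse where
  nil := hA.nil
  shuffleSum_eq_zero x y hx hy := by
    rw [← shuffleSum_reverse, hA.shuffleSum_eq_zero _ _ (by simpa using hx) (by simpa using hy)]

theorem shuffleSum_cons {A : List V → K} (hA : IsAlternal A) (x y : List V) (z : V) :
    shuffleSum (fun w => A (z :: w)) x y = (-1) ^ y.length * A ((z :: y).reverse ++ x) := by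
  induction y generalizing x z with
  | nil => simp
  | cons b y ih =>
    have h := hA.shuffleSum_eq_zero (z :: x) (b :: y) (by simp) (by simp)
    rw [shuffleSum_cons_cons, ih] at h
    rw [eq_neg_of_add_eq_zero_left h]
    simp [pow_succ]

theorem apply_reverse_cons {A : List V → K} (hA : IsAlternal A) (y : List V) (z : V) :
    A (z :: y).reverse = (-1) ^ y.length * A (z :: y) := by
  have h := hA.shuffleSum_cons [] y z
  rw [shuffleSum_nil_left, List.append_nil] at h
  rw [h, ← mul_assoc, ← mul_pow]
  simp

theorem shuffleSum_mu {A B : List V → K} (hA : IsAlternal A) (hB : IsAlternal B) {x y : List V}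
    (hx : x ≠ []) (hy : y ≠ []) : shuffleSum (mu A B) x y = A x * B y + A y * B x := by
  have expansion : shuffleSum (mu A B) x y = splitSum (fun x₁ x₂ => splitSum (fun y₁ y₂ =>
      (A y₁ * B y₂) * counit x₂ * counit x₁ + (A y₁ * B x₂) * counit y₂ * counit x₁ +
      ((A x₁ * B y₂) * counit y₁ * counit x₂ + (A x₁ * B x₂) * counit y₂ * counit y₁)) y) x := by
    refine (shuffleSum_splitSum _ x y).trans ?_
    refine splitSum_congr fun x₁ x₂ _ => splitSum_congr fun y₁ y₂ _ => ?_
    simp only [shuffleSum_mul_left, shuffleSum_mul_right, hA.shuffleSum_eq, hB.shuffleSum_eq]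
    ring
  obtain ⟨a, x, rfl⟩ := List.exists_cons_of_ne_nil hx
  obtain ⟨b, y, rfl⟩ := List.exists_cons_of_ne_nil hy
  rw [expansion]
  simp only [splitSum_add, splitSum_mul_right, splitSum_mul_counit_left,
    splitSum_mul_counit_right, counit_cons]
  ring

theorem mu_sub_mu {A B : List V → K} (hA : IsAlternal A) (hB : IsAlternal B) :
    IsAlternal (mu A B - mu B A) where
  nil := by simp [mu_apply, hA.nil]
  shuffleSum_eq_zero x y hx hy := (shuffleSum_sub _ _ x y).trans <| by
    rw [hA.shuffleSum_mu hB hx hy, hB.shuffleSum_mu hA hx hy]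
    ring

end IsAlternal

end Alternal

section Insertion

variable {V K : Type*} [CommRing K] (h : V → List V → K) (φ : V → List V → V) (A : List V → K)

/-- The sum over `w = abzc`, with `z` a letter, of `A (a φ(z, b) c) * h z b`: the factor `b` is
absorbed into the letter that follows it. -/
def absorbLeft (w : List V) : K :=
  pivotSum (fun s z c => splitSum (fun a b => A (a ++ φ z b :: c) * h z b) s) w

/-- The sum over `w = azbc`, with `z` a letter, of `A (a φ(z, b) c) * h z b`: the factor `b` is
absorbed into the letter that precedes it. -/
def absorbRight (w : List V) : K :=
  pivotSum (fun a z s => splitSum (fun b c => A (a ++ φ z b :: c) * h z b) s) w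

/-- The common shape of the operator `arit` in the variables `u` and in the variables `v`. The
merging rule `φ` and the weight `h` are left free since the two cases differ in them. -/
def absorb : List V → K := absorbLeft h φ A - absorbRight h φ A

/-- The part of the sum of `absorbLeft h φ A` over the shuffles of `x` and `y` in which the
absorbing letter comes from `x` and the absorbed factor from `y`; it is the same for
`absorbRight`. -/
def crossAbsorb (x y : List V) : K :=
  pivotSum (fun x₁ z x₂ => splitSum (fun y₁ t => splitSum (fun b y₂ =>
    shuffleSum (fun a => shuffleSum (fun c => A (a ++ φ z b :: c)) x₂ y₂) x₁ y₁ * h z b) t) y) x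

variable {h φ A}

theorem shuffleSum_absorbed (hh : ∀ z, IsAlternal (h z))
    (hφ : ∀ z b b', b.Perm b' → φ z b = φ z b') (z : V) (x₁ x₂ x₃ y₁ y₂ y₃ : List V) :
    shuffleSum (fun a => shuffleSum (fun b => shuffleSum (fun c =>
        A (a ++ φ z b :: c) * h z b) x₃ y₃) x₂ y₂) x₁ y₁ =
      shuffleSum (fun a => shuffleSum (fun c => A (a ++ φ z (x₂ ++ y₂) :: c)) x₃ y₃) x₁ y₁ *
        (h z y₂ * counit x₂ + h z x₂ * counit y₂) := by
  rw [← (hh z).shuffleSum_eq, ← shuffleSum_mul_right]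
  refine shuffleSum_congr fun a _ => ?_
  rw [← shuffleSum_mul_left]
  refine shuffleSum_congr fun b hb => ?_
  rw [shuffleSum_mul_right, hφ z _ _ hb]

theorem splitSum_shuffleSum_eq_zero (hA : IsAlternal A) {y : List V} (hy : y ≠ []) (z : V)
    (x₁ x₂ : List V) :
    splitSum (fun y₁ y₂ =>
      shuffleSum (fun a => shuffleSum (fun c => A (a ++ z :: c)) x₂ y₂) x₁ y₁) y = 0 := by
  rw [← shuffleSum_append_cons, hA.shuffleSum_eq_zero _ _ (by simp) hy]

theorem pivotShuffleSum_absorbLeft (hA : IsAlternal A) (hh : ∀ z, IsAlternal (h z))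
    (hφ : ∀ z b b', b.Perm b' → φ z b = φ z b') (x : List V) {y : List V} (hy : y ≠ []) :
    pivotShuffleSum (fun s z c => splitSum (fun a b => A (a ++ φ z b :: c) * h z b) s) x y =
      crossAbsorb h φ A x y := by
  refine pivotSum_congr fun s z x₃ _ => ?_
  have absorbed_from_y_or_x : ∀ t y₃ : List V,
      shuffleSum (fun s => shuffleSum (fun c =>
        splitSum (fun a b => A (a ++ φ z b :: c) * h z b) s) x₃ y₃) s t =
      splitSum (fun y₁ b =>
        shuffleSum (fun a => shuffleSum (fun c => A (a ++ φ z b :: c)) x₃ y₃) s y₁ * h z b) t +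
      splitSum (fun x₁ b =>
        shuffleSum (fun a => shuffleSum (fun c => A (a ++ φ z b :: c)) x₃ y₃) x₁ t * h z b) s := by
    intro t y₃
    simp only [shuffleSum_splitSum_comm]
    refine (shuffleSum_splitSum _ s t).trans ?_
    simp only [shuffleSum_absorbed hh hφ, mul_add, splitSum_add, ← mul_assoc, splitSum_mul_right,
      splitSum_mul_counit_right, List.nil_append, List.append_nil]
  simp only [absorbed_from_y_or_x, splitSum_add]
  rw [splitSum_comm (fun y₁ y₂ x₁ b => shuffleSum (fun a => shuffleSum (fun c =>
    A (a ++ φ z b :: c)) x₃ y₂) x₁ y₁ * h z b)]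
  simp only [splitSum_mul_right, splitSum_shuffleSum_eq_zero hA hy, zero_mul, splitSum_zero,
    add_zero]
  exact splitSum_assoc (fun y₁ b y₂ => shuffleSum (fun a => shuffleSum (fun c =>
    A (a ++ φ z b :: c)) x₃ y₂) s y₁ * h z b) y

theorem pivotShuffleSum_absorbRight (hA : IsAlternal A) (hh : ∀ z, IsAlternal (h z))
    (hφ : ∀ z b b', b.Perm b' → φ z b = φ z b') (x : List V) {y : List V} (hy : y ≠ []) :
    pivotShuffleSum (fun a z s => splitSum (fun b c => A (a ++ φ z b :: c) * h z b) s) x y =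
      crossAbsorb h φ A x y := by
  refine pivotSum_congr fun x₁ z s _ => ?_
  have absorbed_from_y_or_x : ∀ y₁ t : List V,
      shuffleSum (fun a => shuffleSum (fun s =>
        splitSum (fun b c => A (a ++ φ z b :: c) * h z b) s) s t) x₁ y₁ =
      splitSum (fun b y₃ =>
        shuffleSum (fun a => shuffleSum (fun c => A (a ++ φ z b :: c)) s y₃) x₁ y₁ * h z b) t +
      splitSum (fun b x₃ =>
        shuffleSum (fun a => shuffleSum (fun c => A (a ++ φ z b :: c)) x₃ t) x₁ y₁ * h z b) s := by
    intro y₁ t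
    simp only [shuffleSum_splitSum, shuffleSum_splitSum_comm, shuffleSum_absorbed hh hφ, mul_add,
      splitSum_add, ← mul_assoc, splitSum_mul_right, splitSum_mul_counit_left, List.nil_append,
      List.append_nil]
  simp only [absorbed_from_y_or_x, splitSum_add]
  rw [splitSum_comm (fun y₁ y₂ b x₃ => shuffleSum (fun a => shuffleSum (fun c =>
    A (a ++ φ z b :: c)) x₃ y₂) x₁ y₁ * h z b)]
  simp only [splitSum_mul_right, splitSum_shuffleSum_eq_zero hA hy, zero_mul, splitSum_zero,
    add_zero]

theorem IsAlternal.absorb (hA : IsAlternal A) (hh : ∀ z, IsAlternal (h z))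
    (hφ : ∀ z b b', b.Perm b' → φ z b = φ z b') : IsAlternal (absorb h φ A) where
  nil := sub_self 0
  shuffleSum_eq_zero x y hx hy := by
    refine (shuffleSum_sub _ _ x y).trans (sub_eq_zero.2 ?_)
    refine (shuffleSum_pivotSum _ x y).trans (Eq.trans ?_ (shuffleSum_pivotSum _ x y).symm)
    rw [pivotShuffleSum_absorbLeft hA hh hφ x hy, pivotShuffleSum_absorbLeft hA hh hφ y hx,
      pivotShuffleSum_absorbRight hA hh hφ x hy, pivotShuffleSum_absorbRight hA hh hφ y hx]

end Insertion

section Flank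

variable {V K : Type*} [CommRing K]

/-- The difference between the values at a word without its last and without its first letter;
`arit B` is the contraction with weight `flank B`. -/
def flank (B : List V → K) (f : List V) : K := B f.dropLast - B f.tail

theorem mu_flank_right {C : List V → K} (hC : C [] = 0) (B : List V → K) (i : List V) (y : V) :
    mu B (flank C) (i ++ [y]) = mu B C i - pivotSum (fun a _ b => B a * C b) (i ++ [y]) := by
  simp only [mu_apply, flank, mul_sub, splitSum_sub]
  congr 1
  · rw [splitSum_concat]
    simp [hC]
  · rw [splitSum_eq_nil_right_add]
    simp [hC]

theorem mu_flank_left {C : List V → K} (hC : C [] = 0) (B : List V → K) (x : V) (m : List V) :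
    mu (flank C) B (x :: m) = pivotSum (fun a _ b => C a * B b) (x :: m) - mu C B m := by
  simp only [mu_apply, flank, sub_mul, splitSum_sub]
  congr 1
  · rw [splitSum_eq_nil_left_add]
    simp [hC]
  · rw [splitSum_cons]
    simp [hC]

end Flank

/-! ### Contractions and the Jacobi identity -/

section Contraction

variable {V K : Type*} [AddCommMonoid V] [CommRing K]

/-- The operator that contracts one factor `f` of a word to the letter `f.sum`, with weight
`γ f`, as a bilinear map in `γ` and the function it is applied to. It is dual to the coderivation
of the algebra of words with corestriction `f ↦ γ f • f.sum`. -/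
def contract : (List V → K) →ₗ[K] (List V → K) →ₗ[K] List V → K :=
  LinearMap.mk₂ K
    (fun γ A w => splitSum (fun a t => splitSum (fun f c => A (a ++ f.sum :: c) * γ f) t) w)
    (fun γ δ A => by funext w; simp only [Pi.add_apply, mul_add, splitSum_add])
    (fun k γ A => by
      funext w; simp only [Pi.smul_apply, smul_eq_mul, mul_left_comm _ k, splitSum_mul_left])
    (fun γ A B => by funext w; simp only [Pi.add_apply, add_mul, splitSum_add])
    (fun k γ A => by
      funext w; simp only [Pi.smul_apply, smul_eq_mul, mul_assoc, splitSum_mul_left])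

theorem contract_apply (γ A : List V → K) (w : List V) :
    contract γ A w =
      splitSum (fun a t => splitSum (fun f c => A (a ++ f.sum :: c) * γ f) t) w := rfl

theorem contract_apply' (γ A : List V → K) (w : List V) :
    contract γ A w =
      splitSum (fun s c => splitSum (fun a f => A (a ++ f.sum :: c) * γ f) s) w :=
  (splitSum_assoc _ w).symm

/-- The contraction of two disjoint factors, the left one with weight `γ` and the right one with
weight `δ`. -/
def contractTwo (γ δ A : List V → K) (w : List V) : K :=
  splitSum (fun a r => splitSum (fun f s => splitSum (fun b t => splitSum (fun g c =>
    A (a ++ f.sum :: (b ++ g.sum :: c)) * δ g * γ f) t) s) r) w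

theorem contract_append_cons (δ A : List V → K) (a c : List V) (x : V) :
    contract δ A (a ++ x :: c) =
      splitSum (fun a₁ s => splitSum (fun g b => A (a₁ ++ g.sum :: (b ++ x :: c)) * δ g) s) a +
      splitSum (fun a₁ a₂ => splitSum (fun c₁ c₂ =>
        A (a₁ ++ (a₂ ++ x :: c₁).sum :: c₂) * δ (a₂ ++ x :: c₁)) c) a +
      splitSum (fun b t => splitSum (fun g c₂ => A (a ++ x :: (b ++ g.sum :: c₂)) * δ g) t) c := by
  simp only [contract_apply, splitSum_append_cons, splitSum_add, List.append_assoc,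
    List.cons_append]

theorem contract_contract_weight (γ δ A : List V → K) (w : List V) :
    contract (contract γ δ) A w =
      splitSum (fun s c => splitSum (fun a f => splitSum (fun a₁ a₂ => splitSum (fun c₁ c₂ =>
        A (a₁ ++ (a₂ ++ f.sum :: c₁).sum :: c₂) * δ (a₂ ++ f.sum :: c₁) * γ f) c) a) s) w := by
  have expansion : contract (contract γ δ) A w =
      splitSum (fun a₁ t => splitSum (fun g c₂ => splitSum (fun a₂ r => splitSum (fun f c₁ =>
        A (a₁ ++ (a₂ ++ f.sum :: c₁).sum :: c₂) * δ (a₂ ++ f.sum :: c₁) * γ f) r) g) t) w := by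
    refine splitSum_congr fun a₁ t _ => splitSum_congr fun g c₂ _ => ?_
    simp only [contract_apply, ← splitSum_mul_left]
    refine splitSum_congr fun a₂ r hg => splitSum_congr fun f c₁ hr => ?_
    subst hg hr
    simp only [List.sum_append, List.sum_cons, mul_assoc]
  rw [expansion]
  simp only [splitSum_assoc]

theorem contract_contract (γ δ A : List V → K) (w : List V) :
    contract γ (contract δ A) w =
      contract (contract γ δ) A w + contractTwo γ δ A w + contractTwo δ γ A w := by
  rw [contract_contract_weight, contract_apply' γ]
  simp only [contract_append_cons, add_mul, splitSum_add, ← splitSum_mul_right, splitSum_assoc,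
    contractTwo, mul_right_comm _ (γ _)]
  abel

theorem contract_commutator (γ δ A : List V → K) :
    contract γ (contract δ A) - contract δ (contract γ A) =
      contract (contract γ δ - contract δ γ) A := by
  funext w
  simp only [map_sub, LinearMap.sub_apply, Pi.sub_apply, contract_contract]
  abel

theorem contract_mu (γ A B : List V → K) :
    contract γ (mu A B) = mu (contract γ A) B + mu A (contract γ B) := by
  funext w
  rw [contract_apply', Pi.add_apply, mu_apply, mu_apply]
  simp only [mu_apply, contract_apply, splitSum_append_cons, add_mul, splitSum_add,
    ← splitSum_mul_right, ← splitSum_mul_left, splitSum_assoc, mul_assoc, mul_comm (γ _)]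
  abel

theorem contract_dropLast (γ B : List V → K) (i : List V) (y : V) :
    contract γ (fun w => B w.dropLast) (i ++ [y]) = contract γ B i + mu B γ (i ++ [y]) := by
  have dropLast_nil : ∀ a f : List V, (a ++ f.sum :: []).dropLast = a := by simp
  have dropLast_concat : ∀ a f c : List V,
      (a ++ f.sum :: (c ++ [y])).dropLast = a ++ f.sum :: c := by
    intro a f c
    rw [← List.cons_append, ← List.append_assoc, List.dropLast_concat]
  rw [contract_apply', contract_apply', splitSum_concat, mu_apply]
  simp only [dropLast_nil, dropLast_concat]

theorem contract_tail (γ B : List V → K) (x : V) (m : List V) :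
    contract γ (fun w => B w.tail) (x :: m) = contract γ B m + mu γ B (x :: m) := by
  rw [contract_apply, splitSum_cons, add_comm]
  simp only [List.nil_append, List.tail_cons, List.cons_append, contract_apply, mu_apply,
    mul_comm (γ _)]

end Contraction

section Ari

variable {V K : Type*} [AddCommMonoid V] [CommRing K]

/-- The operator `arit(B)·A` on functions on words, as a bilinear map in `B` and `A`. -/
def arit : (List V → K) →ₗ[K] (List V → K) →ₗ[K] List V → K :=
  LinearMap.mk₂ K (fun B A => absorb (fun _ => B) (fun z b => z + b.sum) A)
    (fun B C A => by
      funext w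
      simp only [absorb, absorbLeft, absorbRight, Pi.add_apply, Pi.sub_apply, mul_add,
        splitSum_add, pivotSum_add]
      abel)
    (fun k B A => by
      funext w
      simp only [absorb, absorbLeft, absorbRight, Pi.smul_apply, Pi.sub_apply, smul_eq_mul,
        mul_left_comm _ k, splitSum_mul_left, pivotSum_mul_left, mul_sub])
    (fun B A C => by
      funext w
      simp only [absorb, absorbLeft, absorbRight, Pi.add_apply, Pi.sub_apply, add_mul,
        splitSum_add, pivotSum_add]
      abel)
    (fun k B A => by
      funext w
      simp only [absorb, absorbLeft, absorbRight, Pi.smul_apply, Pi.sub_apply, smul_eq_mul,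
        mul_assoc, splitSum_mul_left, pivotSum_mul_left, mul_sub])

theorem arit_eq_absorb (B A : List V → K) :
    arit B A = absorb (fun _ => B) (fun z b => z + b.sum) A := rfl

/-- The ari-bracket of functions on words, as a bilinear map. -/
def ari : (List V → K) →ₗ[K] (List V → K) →ₗ[K] List V → K := arit.flip - arit + (mu - mu.flip)

theorem ari_eq (A B : List V → K) :
    ari A B = arit B A - arit A B + (mu A B - mu B A) := rfl

theorem IsAlternal.ari {A B : List V → K} (hA : IsAlternal A) (hB : IsAlternal B) :
    IsAlternal (ari A B) :=
  ((hA.absorb (fun _ => hB) fun _ _ _ h => by rw [h.sum_eq]).sub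
    (hB.absorb (fun _ => hA) fun _ _ _ h => by rw [h.sum_eq])).add (hA.mu_sub_mu hB)

theorem ari_nil {A B : List V → K} (hA : A [] = 0) : ari A B [] = 0 := by
  simp [ari_eq, arit_eq_absorb, absorb, absorbLeft, absorbRight, mu_apply, hA]

theorem absorb_eq_contract {B : List V → K} (hB : B [] = 0) (ρ : V → K) (A : List V → K) :
    absorb (fun z b => B b * ρ (z + b.sum)) (fun z b => z + b.sum) A =
      contract (fun f => flank B f * ρ f.sum) A := by
  funext w
  have left := pivotSum_splitSum_concat
    (fun a f c => A (a ++ f.sum :: c) * (B f.dropLast * ρ f.sum)) (by simp [hB]) w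
  have right := pivotSum_splitSum_cons
    (fun a f c => A (a ++ f.sum :: c) * (B f.tail * ρ f.sum)) (by simp [hB]) w
  simp only [List.dropLast_concat, List.tail_cons, List.sum_append, List.sum_cons,
    List.sum_nil, add_zero] at left right
  simp only [contract_apply, flank, sub_mul, mul_sub, splitSum_sub, ← left, ← right,
    absorb, absorbLeft, absorbRight, Pi.sub_apply, add_comm]

theorem arit_eq_contract {B : List V → K} (hB : B [] = 0) : arit B = contract (flank B) :=
  LinearMap.ext fun A => by
    simpa only [mul_one, arit_eq_absorb] using absorb_eq_contract hB (fun _ => 1) A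

theorem arit_mu {D : List V → K} (hD : D [] = 0) (A B : List V → K) :
    arit D (mu A B) = mu (arit D A) B + mu A (arit D B) := by
  rw [arit_eq_contract hD, contract_mu]

theorem contract_flank {B C : List V → K} (hC : C [] = 0) {t i m : List V} {x y : V}
    (hi : t = i ++ [y]) (hm : t = x :: m) :
    contract (flank C) (flank B) t =
      arit C B i - arit C B m + mu B C i + mu C B m
        - pivotSum (fun a _ b => B a * C b) t - pivotSum (fun a _ b => C a * B b) t := by
  have flank_eq : flank B = (fun w => B w.dropLast) - fun w => B w.tail := rfl
  have dropLast_part : contract (flank C) (fun w => B w.dropLast) t =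
      contract (flank C) B i + (mu B C i - pivotSum (fun a _ b => B a * C b) t) := by
    rw [hi, contract_dropLast, mu_flank_right hC]
  have tail_part : contract (flank C) (fun w => B w.tail) t =
      contract (flank C) B m + (pivotSum (fun a _ b => C a * B b) t - mu C B m) := by
    rw [hm, contract_tail, mu_flank_left hC]
  rw [flank_eq, map_sub, Pi.sub_apply, arit_eq_contract hC, dropLast_part, tail_part]
  abel

theorem contract_flank_sub {B C : List V → K} (hB : B [] = 0) (hC : C [] = 0) :
    contract (flank C) (flank B) - contract (flank B) (flank C) = flank (ari B C) := by
  funext t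
  rcases t with _ | ⟨x, m⟩
  · simp [contract_apply, flank]
  · obtain ⟨i, y, hi⟩ : ∃ i y, x :: m = i ++ [y] :=
      ⟨_, _, (List.dropLast_append_getLast (List.cons_ne_nil x m)).symm⟩
    have flank_ari : flank (ari B C) (x :: m) = ari B C i - ari B C m := by
      rw [flank, List.tail_cons, hi, List.dropLast_concat]
    rw [Pi.sub_apply, contract_flank hC hi rfl, contract_flank hB hi rfl, flank_ari]
    simp only [ari_eq, Pi.add_apply, Pi.sub_apply]
    abel

theorem arit_ari {B C : List V → K} (hB : B [] = 0) (hC : C [] = 0) (A : List V → K) :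
    arit (ari B C) A = arit C (arit B A) - arit B (arit C A) := by
  rw [arit_eq_contract (ari_nil hB), ← contract_flank_sub hB hC, ← contract_commutator,
    arit_eq_contract hB, arit_eq_contract hC]

theorem ari_singleton {A B : List V → K} (hA : A [] = 0) (hB : B [] = 0) (z : V) :
    ari A B [z] = 0 := by
  simp [ari_eq, arit_eq_absorb, absorb, absorbLeft, absorbRight, pivotSum_cons, mu_apply,
    splitSum_cons, hA, hB]

theorem ari_self (A : List V → K) : ari A A = 0 := by
  simp [ari_eq]

theorem ari_jacobi {A B C : List V → K} (hA : A [] = 0) (hB : B [] = 0) (hC : C [] = 0) :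
    ari A (ari B C) = ari (ari A B) C + ari B (ari A C) := by
  rw [ari_eq A (ari B C), ari_eq (ari A B) C, ari_eq B (ari A C), arit_ari hB hC,
    arit_ari hA hB, arit_ari hA hC]
  simp only [ari_eq, map_add, map_sub, LinearMap.add_apply, LinearMap.sub_apply, arit_mu hA,
    arit_mu hB, arit_mu hC, mu_assoc]
  abel

end Ari

/-! ### The bracket in differences of variables -/

section Increments

variable {V K : Type*} [AddCommGroup V]

theorem getLastD_append {α : Type*} (p : α) (s t : List α) :
    (s ++ t).getLastD p = t.getLastD (s.getLastD p) := by
  induction s generalizing p with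
  | nil => rfl
  | cons q s ih => rw [List.cons_append, List.getLastD_cons, List.getLastD_cons, ih]

/-- The successive differences `q₁ - p, q₂ - q₁, …, q_r - q_{r-1}` of a sequence `p, q₁, …, q_r`.
They turn a function of the variables `u` into a function of the variables `v`. -/
def increments : V → List V → List V
  | _, [] => []
  | p, q :: w => (q - p) :: increments q w

@[simp] theorem increments_nil (p : V) : increments p [] = [] := rfl

@[simp] theorem increments_cons (p q : V) (w : List V) :
    increments p (q :: w) = (q - p) :: increments q w := rfl

@[simp] theorem length_increments (p : V) (w : List V) : (increments p w).length = w.length := by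
  induction w generalizing p with
  | nil => rfl
  | cons q w ih => simp [ih]

theorem increments_append (p : V) (s t : List V) :
    increments p (s ++ t) = increments p s ++ increments (s.getLastD p) t := by
  induction s generalizing p with
  | nil => rfl
  | cons q s ih => rw [List.cons_append, increments_cons, ih, List.getLastD_cons]; rfl

theorem sum_increments (p : V) (w : List V) : (increments p w).sum = w.getLastD p - p := by
  induction w generalizing p with
  | nil => rw [increments_nil, List.sum_nil, List.getLastD_nil, sub_self]
  | cons q w ih => rw [increments_cons, List.sum_cons, ih, List.getLastD_cons]; abel

theorem increments_map_neg (p : V) (w : List V) :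
    increments (-p) (w.map (-·)) = (increments p w).map (-·) := by
  induction w generalizing p with
  | nil => rfl
  | cons q w ih => simp [ih, neg_add_eq_sub]

theorem increments_map_sub (p z : V) (w : List V) :
    increments (p - z) (w.map (· - z)) = increments p w := by
  induction w generalizing p with
  | nil => rfl
  | cons q w ih => simp [ih]

theorem increments_reverse (p q : V) (w : List V) :
    increments p (q :: w).reverse = ((increments q (w ++ [p])).map (-·)).reverse := by
  induction w generalizing q with
  | nil => simp
  | cons r w ih =>
    have getLastD_reverse : (r :: w).reverse.getLastD p = r := by
      rw [List.reverse_cons, List.getLastD_concat]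
    rw [List.reverse_cons, increments_append, ih, getLastD_reverse]
    simp

theorem increments_surjective (p : V) : Function.Surjective (increments p) := by
  intro w
  induction w generalizing p with
  | nil => exact ⟨[], rfl⟩
  | cons z w ih =>
    obtain ⟨v, rfl⟩ := ih (z + p)
    exact ⟨(z + p) :: v, by simp⟩

theorem splitSum_increments [AddCommMonoid K] (F : List V → List V → K) (p : V) (w : List V) :
    splitSum F (increments p w) =
      splitSum (fun s t => F (increments p s) (increments (s.getLastD p) t)) w := by
  induction w generalizing p F with
  | nil => rfl
  | cons q w ih =>
    rw [increments_cons, splitSum_cons, splitSum_cons, ih]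
    simp only [increments_cons, List.getLastD_cons]
    rfl

theorem pivotSum_increments [AddCommMonoid K] (F : List V → V → List V → K) (p : V)
    (w : List V) :
    pivotSum F (increments p w) =
      pivotSum (fun s q t => F (increments p s) (q - s.getLastD p) (increments q t)) w := by
  induction w generalizing p F with
  | nil => rfl
  | cons q w ih =>
    rw [increments_cons, pivotSum_cons, pivotSum_cons, ih]
    simp only [increments_cons, List.getLastD_cons]
    rfl

end Increments

section AriIncrements

variable {V K : Type*} [AddCommGroup V] [CommRing K]

/-- Push-invariance: the value at the increments of a sequence `p, w₁, …, w_r, y` does not change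
when the sequence is rotated. -/
def IsPushInvariant (A : List V → K) : Prop :=
  ∀ (p : V) (w : List V) (y : V), A (increments p (w ++ [y])) = A (increments y (p :: w))

theorem absorbLeft_increments_add_mu (A B : List V → K) (p : V) (w : List V) :
    absorbLeft (fun _ => B) (fun z b => z + b.sum) A (increments p w) +
        mu A B (increments p w) =
      mu (fun w => B (increments p w)) (fun w => A (increments p w)) w +
        absorbRight (fun z b => B (increments z b)) (fun z _ => z)
          (fun w => A (increments p w)) w := by
  have absorbLeft_part :
      absorbLeft (fun _ => B) (fun z b => z + b.sum) A (increments p w) =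
        splitSum (fun a r => pivotSum (fun b q t =>
          A (increments p (a ++ q :: t)) * B (increments (a.getLastD p) b)) r) w := by
    rw [absorbLeft, pivotSum_increments, ← pivotSum_splitSum]
    refine pivotSum_congr fun s q t _ => ?_
    rw [splitSum_increments]
    refine splitSum_congr fun a b hs => ?_
    rw [sum_increments, hs, getLastD_append, increments_append, increments_cons, sub_add_sub_cancel]
  have mu_part : mu A B (increments p w) =
      splitSum (fun a r => A (increments p a) * B (increments (a.getLastD p) r)) w := by
    rw [mu_apply, splitSum_increments]
  have regrouped : ∀ a r : List V,
      pivotSum (fun b q t =>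
          A (increments p (a ++ q :: t)) * B (increments (a.getLastD p) b)) r +
        A (increments p a) * B (increments (a.getLastD p) r) =
      splitSum (fun b c => A (increments p (a ++ c)) * B (increments (a.getLastD p) b)) r := by
    intro a r
    rw [splitSum_eq_nil_right_add, add_comm, List.append_nil]
  rw [absorbLeft_part, mu_part, ← splitSum_add]
  simp only [regrouped]
  rw [splitSum_eq_nil_left_add]
  simp only [List.nil_append, List.getLastD_nil, List.getLastD_concat, List.append_assoc,
    List.cons_append, mu_apply, mul_comm, absorbRight]

theorem absorbRight_increments (A : List V → K) {B : List V → K} (hB : B [] = 0)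
    (hpush : IsPushInvariant B) (p : V) (w : List V) :
    absorbRight (fun _ => B) (fun z b => z + b.sum) A (increments p w) =
      absorbLeft (fun z b => B (increments z b)) (fun z _ => z)
        (fun w => A (increments p w)) w := by
  -- The summand attached to the factor `f = q₁ … q_m` of `w`, whose increments are taken from `q₁`.
  let F (a f c : List V) : K :=
    A (increments p (a ++ f.getLastD p :: c)) * B (increments p f).tail
  have F_nil : ∀ a c, F a [] c = 0 := fun a c => by
    simp only [F, increments_nil, List.tail_nil, hB, mul_zero]
  calc absorbRight (fun _ => B) (fun z b => z + b.sum) A (increments p w)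
    _ = pivotSum (fun a q s => splitSum (fun b c => F a (q :: b) c) s) w := by
      rw [absorbRight, pivotSum_increments]
      refine pivotSum_congr fun s q t _ => ?_
      rw [splitSum_increments]
      refine splitSum_congr fun b c _ => ?_
      simp only [F, increments_append, increments_cons, List.tail_cons, List.getLastD_cons,
        sum_increments, sub_add_sub_cancel']
    _ = pivotSum (fun s z c => splitSum (fun a b => F a (b ++ [z]) c) s) w :=
      (pivotSum_splitSum_cons F F_nil w).trans (pivotSum_splitSum_concat F F_nil w).symm
    _ = _ := by
      refine pivotSum_congr fun s z c _ => splitSum_congr fun a b _ => ?_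
      have rotated : B (increments p (b ++ [z])).tail = B (increments z b) := by
        cases b with
        | nil => rfl
        | cons q b => exact hpush q b z
      simp only [F, List.getLastD_concat, rotated]

theorem arit_increments (A : List V → K) {B : List V → K} (hB : B [] = 0)
    (hpush : IsPushInvariant B) (p : V) (w : List V) :
    arit B A (increments p w) + mu A B (increments p w) =
      mu (fun w => B (increments p w)) (fun w => A (increments p w)) w -
        absorb (fun z b => B (increments z b)) (fun z _ => z)
          (fun w => A (increments p w)) w := by
  rw [arit_eq_absorb, absorb, absorb, Pi.sub_apply, Pi.sub_apply,
    absorbRight_increments A hB hpush, sub_add_eq_add_sub, absorbLeft_increments_add_mu]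
  ring

theorem ari_increments {A B : List V → K} (hA : A [] = 0) (hB : B [] = 0)
    (hAp : IsPushInvariant A) (hBp : IsPushInvariant B) (p : V) :
    (fun w => ari A B (increments p w)) =
      mu (fun w => B (increments p w)) (fun w => A (increments p w)) -
          mu (fun w => A (increments p w)) (fun w => B (increments p w)) +
        (absorb (fun z b => A (increments z b)) (fun z _ => z) (fun w => B (increments p w)) -
          absorb (fun z b => B (increments z b)) (fun z _ => z)
            (fun w => A (increments p w))) := by
  funext w
  simp only [ari_eq, Pi.add_apply, Pi.sub_apply]
  linear_combination arit_increments A hB hBp p w - arit_increments B hA hAp p w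

theorem IsAlternal.ari_increments {A B : List V → K} (hA : A [] = 0) (hB : B [] = 0)
    (hA' : ∀ p, IsAlternal fun w => A (increments p w))
    (hB' : ∀ p, IsAlternal fun w => B (increments p w))
    (hAp : IsPushInvariant A) (hBp : IsPushInvariant B) (p : V) :
    IsAlternal fun w => WordFun.ari A B (increments p w) := by
  rw [WordFun.ari_increments hA hB hAp hBp p]
  exact ((hB' p).mu_sub_mu (hA' p)).add
    (((hB' p).absorb hA' fun _ _ _ _ => rfl).sub ((hA' p).absorb hB' fun _ _ _ _ => rfl))

end AriIncrements

section Push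

variable {V K : Type*} [AddCommGroup V] [CommRing K] {A : List V → K}

theorem IsAlternal.apply_increments_cons (hA : IsAlternal A)
    (hA' : ∀ p, IsAlternal fun w => A (increments p w)) (p q : V) (w : List V) :
    A (increments p (q :: w)) = A ((increments q (w ++ [p])).map (-·)) := by
  have reversed := (hA' p).apply_reverse_cons w q
  rw [increments_reverse] at reversed
  obtain ⟨z, y, hzy⟩ : ∃ z y, (increments q (w ++ [p])).map (-·) = z :: y :=
    List.exists_cons_of_length_pos (by simp)
  have length_eq : y.length = w.length := by
    simpa using (congrArg List.length hzy).symm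
  rw [hzy, hA.apply_reverse_cons, length_eq] at reversed
  rw [hzy]
  exact ((isUnit_neg_one.pow _).mul_left_cancel reversed).symm

theorem apply_increments_eq_zero [IsAddTorsionFree K]
    (hA' : ∀ p, IsAlternal fun w => A (increments p w))
    (hrot : ∀ p q w, A (increments q (w ++ [p])) = -A (increments p (q :: w)))
    (p x q : V) (w : List V) : A (increments p (x :: q :: w)) = 0 := by
  have shuffle₁ := (hA' p).shuffleSum_eq_zero [x] (q :: w) (by simp) (by simp)
  have shuffle₂ := (hA' q).shuffleSum_eq_zero [x] (w ++ [p]) (by simp) (by simp)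
  rw [← List.nil_append [x], shuffleSum_append_cons] at shuffle₁ shuffle₂
  simp only [shuffleSum_nil_left, splitSum_cons, splitSum_concat, List.nil_append]
    at shuffle₁ shuffle₂
  have rotate_once : ∀ a b : List V,
      A (increments q (a ++ x :: (b ++ [p]))) = -A (increments p (q :: a ++ x :: b)) := by
    intro a b
    rw [← List.cons_append, ← List.append_assoc, hrot, List.cons_append]
  have rotate_twice : A (increments q (w ++ [p] ++ [x])) = A (increments p (x :: q :: w)) := by
    rw [hrot, ← List.cons_append, hrot, neg_neg]
  have splitSum_neg : splitSum (fun a b => -A (increments p (q :: a ++ x :: b))) w =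
      -splitSum (fun a b => A (increments p (q :: a ++ x :: b))) w :=
    (map_splitSum (negAddMonoidHom : K →+ K) _ w).symm
  rw [rotate_twice] at shuffle₂
  simp only [rotate_once, splitSum_neg] at shuffle₂
  have twice : A (increments p (x :: q :: w)) + A (increments p (x :: q :: w)) = 0 := by
    linear_combination shuffle₁ + shuffle₂
  exact self_eq_neg.1 (eq_neg_of_add_eq_zero_left twice)

theorem IsAlternal.apply_map_neg [IsAddTorsionFree K] (hA : IsAlternal A)
    (hA' : ∀ p, IsAlternal fun w => A (increments p w)) (heven : ∀ z, A [-z] = A [z])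
    (w : List V) : A (w.map (-·)) = A w := by
  -- The odd part changes sign under rotation, hence vanishes in depth at least two.
  set oddPart : List V → K := fun w => A w - A (w.map (-·)) with oddPart_def
  have oddPart_increments : ∀ p, IsAlternal fun w => oddPart (increments p w) := by
    refine fun p => (hA' p).sub ?_
    simp only [← increments_map_neg]
    exact (hA' (-p)).comp_map (-·)
  have oddPart_rotate : ∀ p q w,
      oddPart (increments q (w ++ [p])) = -oddPart (increments p (q :: w)) := by
    intro p q w
    have rotate := hA.apply_increments_cons hA' p q w
    have rotate_neg := hA.apply_increments_cons hA' (-p) (-q) (w.map (-·))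
    rw [← List.map_cons, increments_map_neg, ← List.map_singleton (f := (-·)), ← List.map_append,
      increments_map_neg, List.map_map, neg_comp_neg, List.map_id] at rotate_neg
    simp only [oddPart_def, rotate, rotate_neg, neg_sub]
  suffices h : oddPart w = 0 from (sub_eq_zero.1 h).symm
  obtain ⟨v, rfl⟩ := increments_surjective 0 w
  rcases v with _ | ⟨x, _ | ⟨q, l⟩⟩
  · simp [oddPart_def]
  · simp [oddPart_def, ← heven x]
  · exact apply_increments_eq_zero oddPart_increments oddPart_rotate 0 x q l

theorem IsAlternal.isPushInvariant [IsAddTorsionFree K] (hA : IsAlternal A)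
    (hA' : ∀ p, IsAlternal fun w => A (increments p w)) (heven : ∀ z, A [-z] = A [z]) :
    IsPushInvariant A := fun p w y => by
  rw [hA.apply_increments_cons hA', hA.apply_map_neg hA' heven]

end Push

end WordFun

/-! ### Evaluation at generic words -/

section Evaluation

variable {K L : Type*} [Field K] [Algebra ℚ K] [Field L] [Algebra ℚ L]

theorem RatFun.map_eval {m : ℕ} (φ : K →ₐ[ℚ] L) (f : RatFun m) (x : Fin m → K) :
    φ (RatFun.eval f x) = RatFun.eval f (fun i => φ (x i)) := by
  simp only [RatFun.eval, map_div₀, MvPolynomial.comp_aeval_apply]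

/-- Evaluation at an algebraically independent tuple, as a homomorphism of fields. -/
noncomputable def RatFun.evalHom {m : ℕ} {x : Fin m → K} (hx : AlgebraicIndependent ℚ x) :
    RatFun m →ₐ[ℚ] K :=
  IsFractionRing.liftAlgHom (g := MvPolynomial.aeval x)
    (algebraicIndependent_iff_injective_aeval.1 hx)

theorem RatFun.evalHom_algebraMap {m : ℕ} {x : Fin m → K} (hx : AlgebraicIndependent ℚ x)
    (p : MvPolynomial (Fin m) ℚ) :
    RatFun.evalHom hx (algebraMap _ _ p) = MvPolynomial.aeval x p := by
  simp [evalHom]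

theorem RatFun.evalHom_apply {m : ℕ} {x : Fin m → K} (hx : AlgebraicIndependent ℚ x)
    (f : RatFun m) : RatFun.evalHom hx f = RatFun.eval f x := by
  conv_lhs => rw [← IsFractionRing.mk'_num_den' (MvPolynomial (Fin m) ℚ) f]
  rw [map_div₀, evalHom_algebraMap, evalHom_algebraMap, RatFun.eval]

theorem RatFun.evalHom_var {m : ℕ} {x : Fin m → K} (hx : AlgebraicIndependent ℚ x)
    (i : Fin m) : RatFun.evalHom hx (Mould.var i) = x i := by
  rw [Mould.var, evalHom_algebraMap, MvPolynomial.aeval_X]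

namespace Mould

theorem eval_get_cast (A : Mould) {n : ℕ} (w : List K) (h : w.length = n) :
    RatFun.eval (A n) (fun i => w.get (i.cast h.symm)) = A.evalWord w := by
  subst h
  rfl

theorem evalWord_ofFn (A : Mould) {n : ℕ} (x : Fin n → K) :
    A.evalWord (List.ofFn x) = RatFun.eval (A n) x := by
  rw [← eval_get_cast A (List.ofFn x) List.length_ofFn]
  simp

theorem map_evalWord (φ : K →ₐ[ℚ] L) (A : Mould) (w : List K) :
    φ (A.evalWord w) = A.evalWord (w.map φ) := by
  rw [evalWord, RatFun.map_eval, ← eval_get_cast A (w.map φ) (List.length_map φ)]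
  simp

theorem evalWord_nil {A : Mould} (hA : A ∈ ARI) : A.evalWord ([] : List K) = 0 := by
  have zero_eq_div : A 0 = algebraMap (MvPolynomial (Fin 0) ℚ) (RatFun 0) 0 /
      algebraMap (MvPolynomial (Fin 0) ℚ) (RatFun 0) 1 := by
    rw [map_zero, zero_div]
    exact hA
  have eval_zero : RatFun.eval (A 0) ([] : List K).get = 0 := by
    rw [zero_eq_div, RatFun.eval_div _ _ _ (by simp)]
    simp
  exact eval_zero

end Mould

end Evaluation

namespace Mould

theorem algebraicIndependent_of_mem_span {F R ι κ : Type*} [Field F] [CommRing R] [Algebra F R]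
    {e : ι → R} (he : AlgebraicIndependent F e) {x : κ → R}
    (hx : ∀ i, x i ∈ Submodule.span F (Set.range e)) (hli : LinearIndependent F x) :
    AlgebraicIndependent F x := by
  simp only [← Finsupp.range_linearCombination] at hx
  choose coeff hcoeff using hx
  obtain ⟨g, hg⟩ := LinearMap.exists_leftInverse_of_injective (Finsupp.linearCombination F x)
    (LinearMap.ker_eq_bot.2 hli)
  have g_apply : ∀ i, g (x i) = Finsupp.single i 1 := fun i => by
    simpa using LinearMap.congr_fun hg (Finsupp.single i 1)
  let form (i : κ) : MvPolynomial ι F := Finsupp.linearCombination F MvPolynomial.X (coeff i)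
  let θ : MvPolynomial ι F →ₐ[F] MvPolynomial κ F :=
    MvPolynomial.aeval fun j => Finsupp.linearCombination F MvPolynomial.X (g (e j))
  have θ_form : ∀ i, θ (form i) = MvPolynomial.X i := by
    intro i
    calc θ (form i) = Finsupp.linearCombination F MvPolynomial.X
          (g (Finsupp.linearCombination F e (coeff i))) := by
          simp [θ, form, Finsupp.linearCombination_apply, Finsupp.sum, map_sum]
      _ = MvPolynomial.X i := by simp [hcoeff, g_apply]
  have form_independent : AlgebraicIndependent F form := by
    refine algebraicIndependent_iff_injective_aeval.2 (Function.LeftInverse.injective (g := θ) ?_)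
    intro p
    rw [MvPolynomial.comp_aeval_apply]
    simp [θ_form]
  have aeval_form : x = fun i => MvPolynomial.aeval e (form i) := by
    funext i
    simp [form, ← hcoeff, Finsupp.linearCombination_apply, Finsupp.sum, map_sum]
  rw [aeval_form]
  exact form_independent.map' (algebraicIndependent_iff_injective_aeval.1 he)

theorem linearIndependent_get_iff {F V : Type*} [DivisionRing F] [AddCommGroup V] [Module F V]
    {w : List V} :
    LinearIndependent F w.get ↔ w.length = Module.finrank F (Submodule.span F {z | z ∈ w}) := by
  rw [linearIndependent_iff_card_eq_finrank_span, Fintype.card_fin, Set.range_list_get, Set.finrank]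

section Generic

variable {K ι : Type*} [CommRing K] [Algebra ℚ K] {e : ι → K}

/-- A word is generic with respect to `e` if its letters are linearly independent linear
combinations of the `e i`. -/
def IsGeneric (e : ι → K) (w : List K) : Prop :=
  (∀ z ∈ w, z ∈ Submodule.span ℚ (Set.range e)) ∧ LinearIndependent ℚ w.get

theorem isGeneric_ofFn {r : ℕ} {e : Fin r → K} (he : LinearIndependent ℚ e) :
    IsGeneric e (List.ofFn e) := by
  refine ⟨fun z hz => Submodule.subset_span ((List.mem_ofFn' e z).1 hz), ?_⟩
  have get_eq : (List.ofFn e).get = e ∘ Fin.cast List.length_ofFn := by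
    funext i
    simp [Fin.cast]
  rw [get_eq]
  exact he.comp _ (Fin.cast_injective _)

namespace IsGeneric

theorem algebraicIndependent (he : AlgebraicIndependent ℚ e) {w : List K} (h : IsGeneric e w) :
    AlgebraicIndependent ℚ w.get :=
  algebraicIndependent_of_mem_span he (fun i => h.1 _ (List.get_mem w i)) h.2

theorem of_mem_span {w w' : List K} (h : IsGeneric e w) (hlen : w'.length = w.length)
    (hw' : ∀ z ∈ w', z ∈ Submodule.span ℚ {z | z ∈ w})
    (hw : ∀ z ∈ w, z ∈ Submodule.span ℚ {z | z ∈ w'}) : IsGeneric e w' := by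
  refine ⟨fun z hz => Submodule.span_le.2 h.1 (hw' z hz), ?_⟩
  have span_eq : Submodule.span ℚ {z | z ∈ w'} = Submodule.span ℚ {z | z ∈ w} :=
    le_antisymm (Submodule.span_le.2 hw') (Submodule.span_le.2 hw)
  rw [linearIndependent_get_iff, span_eq, hlen]
  exact linearIndependent_get_iff.1 h.2

theorem perm {w w' : List K} (h : IsGeneric e w) (hp : w'.Perm w) : IsGeneric e w' :=
  h.of_mem_span hp.length_eq (fun _ hz => Submodule.subset_span (hp.mem_iff.1 hz))
    (fun _ hz => Submodule.subset_span (hp.mem_iff.2 hz))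

theorem sublist {w w' : List K} (h : IsGeneric e w) (hs : w'.Sublist w) : IsGeneric e w' := by
  refine ⟨fun z hz => h.1 z (hs.subset hz), ?_⟩
  obtain ⟨f, hf⟩ := List.sublist_iff_exists_fin_orderEmbedding_get_eq.1 hs
  rw [show w'.get = w.get ∘ f from funext hf]
  exact h.2.comp _ f.injective

theorem neg_cons {z : K} {w : List K} (h : IsGeneric e (z :: w)) : IsGeneric e (-z :: w) := by
  refine h.of_mem_span rfl ?_ ?_ <;> simp only [List.forall_mem_cons]
  · exact ⟨neg_mem (Submodule.subset_span (by simp)),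
      fun _ hx => Submodule.subset_span (by simp [hx])⟩
  · rw [← Submodule.neg_mem_iff]
    exact ⟨Submodule.subset_span (by simp), fun _ hx => Submodule.subset_span (by simp [hx])⟩

theorem add_sum_cons {z : K} {b w : List K} (h : IsGeneric e (z :: w)) (hb : b ⊆ w) :
    IsGeneric e ((z + b.sum) :: w) := by
  have sum_mem_span (y : K) : b.sum ∈ Submodule.span ℚ {x | x ∈ y :: w} :=
    list_sum_mem fun x hx => Submodule.subset_span (List.mem_cons_of_mem y (hb hx))
  refine h.of_mem_span rfl ?_ ?_ <;> simp only [List.forall_mem_cons]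
  · exact ⟨add_mem (Submodule.subset_span (by simp)) (sum_mem_span z),
      fun _ hx => Submodule.subset_span (by simp [hx])⟩
  · refine ⟨?_, fun _ hx => Submodule.subset_span (by simp [hx])⟩
    rw [← add_sub_cancel_right z b.sum]
    exact sub_mem (Submodule.subset_span (by simp)) (sum_mem_span _)

theorem absorbLeft {a b c : List K} {z : K} (h : IsGeneric e (a ++ (b ++ z :: c))) :
    IsGeneric e (a ++ (z + b.sum) :: c) := by
  have letter_first : (z :: (a ++ (b ++ c))).Perm (a ++ (b ++ z :: c)) :=
    List.perm_middle.symm.trans (List.perm_middle.symm.append_left a)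
  exact (((h.perm letter_first).add_sum_cons (b := b) (by simp)).sublist
    (((List.sublist_append_right b c).append_left a).cons_cons _)).perm List.perm_middle

theorem absorbRight {a b c : List K} {z : K} (h : IsGeneric e (a ++ z :: (b ++ c))) :
    IsGeneric e (a ++ (z + b.sum) :: c) :=
  (h.perm (List.perm_middle.append_left a)).absorbLeft

end IsGeneric

theorem forall_mem_increments_iff {S : Submodule ℚ K} {p : K} (hp : p ∈ S) {w : List K} :
    (∀ z ∈ WordFun.increments p w, z ∈ S) ↔ ∀ z ∈ w, z ∈ S := by
  induction w generalizing p with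
  | nil => simp
  | cons q w ih =>
    rw [WordFun.increments_cons, List.forall_mem_cons, List.forall_mem_cons,
      Submodule.sub_mem_iff_left S hp]
    exact and_congr_right ih

theorem isGeneric_increments_iff {w : List K} :
    IsGeneric e (WordFun.increments 0 w) ↔ IsGeneric e w := by
  have increments_mem := (forall_mem_increments_iff (w := w)
    (zero_mem (Submodule.span ℚ {z | z ∈ w}))).2 fun z hz => Submodule.subset_span hz
  have mem_increments := (forall_mem_increments_iff (w := w)
    (zero_mem (Submodule.span ℚ {z | z ∈ WordFun.increments 0 w}))).1
    fun z hz => Submodule.subset_span hz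
  have length_eq := WordFun.length_increments 0 w
  exact ⟨fun h => h.of_mem_span length_eq.symm mem_increments increments_mem,
    fun h => h.of_mem_span length_eq increments_mem mem_increments⟩

end Generic

theorem algebraicIndependent_var {r : ℕ} : AlgebraicIndependent ℚ (var (r := r)) :=
  (MvPolynomial.algebraicIndependent_X (Fin r) ℚ).map'
    (f := Algebra.algHom ℚ (MvPolynomial (Fin r) ℚ) (RatFun r))
    (IsFractionRing.injective (MvPolynomial (Fin r) ℚ) (RatFun r))

theorem isGeneric_vars {r : ℕ} : IsGeneric var (vars r) :=
  isGeneric_ofFn algebraicIndependent_var.linearIndependent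

end Mould

namespace WordFun

/-! ### Shuffles and flexions in terms of indices -/

section Permutations

variable {V K : Type*} [AddCommMonoid K]

theorem shuffleSum_sum {ι : Type*} (t : Finset ι) (F : ι → List V → K) (x y : List V) :
    shuffleSum (fun w => ∑ i ∈ t, F i w) x y = ∑ i ∈ t, shuffleSum (F i) x y := by
  classical
  induction t using Finset.induction_on with
  | empty => simp
  | insert i t hi ih => simp only [Finset.sum_insert hi, shuffleSum_add, ih]

theorem shuffleSum_ite_eq [DecidableEq V] (P : V → Prop) [DecidablePred P] (k : K)
    (w x y : List V) (hx : ∀ z ∈ x, P z) (hy : ∀ z ∈ y, ¬ P z) :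
    shuffleSum (fun v => if v = w then k else 0) x y =
      if w.filter (P ·) = x ∧ w.filter (¬ P ·) = y then k else 0 := by
  induction x, y using shuffle_induction generalizing w with
  | nil_left y =>
    rw [shuffleSum_nil_left]
    refine if_congr ⟨?_, ?_⟩ rfl rfl
    · rintro rfl
      exact ⟨by simpa using hy, by simpa using hy⟩
    · rintro ⟨filter_eq_nil, filter_not_eq⟩
      rw [← filter_not_eq, List.filter_eq_self]
      simpa using filter_eq_nil
  | nil_right x =>
    rw [shuffleSum_nil_right]
    refine if_congr ⟨?_, ?_⟩ rfl rfl
    · rintro rfl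
      exact ⟨by simpa using hx, by simpa using hx⟩
    · rintro ⟨filter_eq, filter_not_eq_nil⟩
      rw [← filter_eq, List.filter_eq_self]
      simpa using filter_not_eq_nil
  | cons_cons a x b y ihx ihy =>
    rw [shuffleSum_cons_cons]
    obtain ⟨ha, hx'⟩ := List.forall_mem_cons.1 hx
    obtain ⟨hb, hy'⟩ := List.forall_mem_cons.1 hy
    cases w with
    | nil => simp
    | cons c w =>
      by_cases hc : P c
      · have hbc : b ≠ c := fun h => hb (h ▸ hc)
        by_cases hac : a = c
        · subst hac
          simpa [hbc, hc] using ihx w hx' hy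
        · simp [hbc, hac, hc, Ne.symm hac]
      · have hac : a ≠ c := fun h => hc (h ▸ ha)
        by_cases hbc : b = c
        · subst hbc
          simpa [hac, hc] using ihy w hx hy'
        · simp [hbc, hac, hc, Ne.symm hbc]

theorem forall_symm_lt_symm_iff {r : ℕ} (P : Fin r → Prop) (σ : Equiv.Perm (Fin r)) :
    (∀ i j, i < j → P (σ.symm i) → P (σ.symm j) → σ.symm i < σ.symm j) ↔
      ∀ i j, i < j → P i → P j → σ i < σ j := by
  constructor
  · intro h i j hij hi hj
    refine (lt_or_gt_of_ne (σ.injective.ne hij.ne)).resolve_right fun hlt => ?_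
    exact hij.asymm (by simpa using h (σ j) (σ i) hlt (by simpa using hj) (by simpa using hi))
  · intro h i j hij hi hj
    refine (lt_or_gt_of_ne (σ.symm.injective.ne hij.ne)).resolve_right fun hlt => ?_
    exact hij.asymm (by simpa using h _ _ hlt hj hi)

theorem filter_ofFn_symm_eq_iff {r : ℕ} (P : Fin r → Prop) [DecidablePred P]
    (σ : Equiv.Perm (Fin r)) :
    (List.ofFn σ.symm).filter (P ·) = (List.finRange r).filter (P ·) ↔
      ∀ i j, i < j → P i → P j → σ i < σ j := by
  have sorted : ((List.finRange r).filter (P ·)).Pairwise (· < ·) :=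
    (List.pairwise_lt_finRange r).sublist List.filter_sublist
  have perm : ((List.ofFn σ.symm).filter (P ·)).Perm ((List.finRange r).filter (P ·)) := by
    rw [List.ofFn_eq_map]
    exact (Equiv.Perm.map_finRange_perm σ.symm).filter _
  have sorted_iff : ((List.ofFn σ.symm).filter (P ·)).Pairwise (· < ·) ↔
      ∀ i j, i < j → P i → P j → σ i < σ j := by
    rw [List.pairwise_filter, List.pairwise_ofFn, ← forall_symm_lt_symm_iff P σ]
    simp only [decide_eq_true_eq]
  rw [← sorted_iff]
  exact ⟨fun h => h ▸ sorted,
    fun h => perm.eq_of_pairwise (fun _ _ _ _ hab hba => absurd hab hba.asymm) h sorted⟩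

theorem mem_take_finRange {r s : ℕ} {i : Fin r} :
    i ∈ (List.finRange r).take s ↔ i.val < s := by
  rw [List.mem_take_iff_getElem]
  constructor
  · rintro ⟨j, hj, rfl⟩
    simpa using (lt_min_iff.1 hj).1
  · intro hi
    exact ⟨i, by simp [hi], by simp⟩

theorem mem_drop_finRange {r s : ℕ} {i : Fin r} :
    i ∈ (List.finRange r).drop s ↔ ¬ i.val < s := by
  rw [List.mem_drop_iff_getElem]
  constructor
  · rintro ⟨j, hj, rfl⟩
    simp
  · intro hi
    exact ⟨i - s, by simp; omega, by simp [Fin.ext_iff]; omega⟩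

theorem filter_finRange_lt (r s : ℕ) :
    (List.finRange r).filter (fun i => decide (i.val < s)) = (List.finRange r).take s := by
  conv_lhs => rw [← List.take_append_drop s (List.finRange r)]
  rw [List.filter_append, List.filter_eq_self.2, List.filter_eq_nil_iff.2, List.append_nil]
  · simp [mem_drop_finRange]
  · simp [mem_take_finRange]

theorem filter_finRange_not_lt (r s : ℕ) :
    (List.finRange r).filter (fun i => decide (¬ i.val < s)) = (List.finRange r).drop s := by
  conv_lhs => rw [← List.take_append_drop s (List.finRange r)]
  rw [List.filter_append, List.filter_eq_nil_iff.2, List.filter_eq_self.2, List.nil_append]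
  · simp [mem_drop_finRange]
  · simp [mem_take_finRange]

theorem exists_perm_of_perm_finRange {r : ℕ} {v : List (Fin r)} (hv : v.Perm (List.finRange r)) :
    ∃ σ : Equiv.Perm (Fin r), v = List.ofFn σ.symm := by
  have hlen : v.length = r := by simpa using hv.length_eq
  have hnodup : v.Nodup := hv.nodup_iff.2 (List.nodup_finRange r)
  let f : Fin r → Fin r := fun i => v.get (i.cast hlen.symm)
  have hf : Function.Injective f := fun i j h => by
    simpa using (List.nodup_iff_injective_get.1 hnodup) h
  refine ⟨(Equiv.ofBijective f (Finite.injective_iff_bijective.1 hf)).symm, ?_⟩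
  exact List.ext_getElem (by simp [hlen]) fun i _ _ => by simp [f]

theorem apply_eq_sum_perm {r : ℕ} {v : List (Fin r)} (hv : v.Perm (List.finRange r))
    (F : List (Fin r) → K) :
    F v = ∑ σ : Equiv.Perm (Fin r), if v = List.ofFn σ.symm then F (List.ofFn σ.symm) else 0 := by
  obtain ⟨σ, rfl⟩ := exists_perm_of_perm_finRange hv
  rw [Finset.sum_eq_single_of_mem σ (Finset.mem_univ σ), if_pos rfl]
  intro τ _ hτ
  refine if_neg fun h => hτ ?_
  exact (Equiv.symm_bijective.injective (Equiv.coe_fn_injective (List.ofFn_injective h))).symm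

theorem filter_lt_ofFn_symm_iff {r : ℕ} (s : ℕ) (σ : Equiv.Perm (Fin r)) :
    (List.ofFn σ.symm).filter (fun i => decide (i.val < s)) = (List.finRange r).take s ↔
      ∀ i j : Fin r, i < j → j.val < s → σ i < σ j := by
  rw [← filter_finRange_lt, filter_ofFn_symm_eq_iff fun i => i.val < s]
  exact ⟨fun h i j hij hj => h i j hij ((Fin.lt_def.1 hij).trans hj) hj,
    fun h i j hij _ hj => h i j hij hj⟩

theorem filter_not_lt_ofFn_symm_iff {r : ℕ} (s : ℕ) (σ : Equiv.Perm (Fin r)) :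
    (List.ofFn σ.symm).filter (fun i => decide (¬ i.val < s)) = (List.finRange r).drop s ↔
      ∀ i j : Fin r, i < j → s ≤ i.val → σ i < σ j := by
  rw [← filter_finRange_not_lt, filter_ofFn_symm_eq_iff fun i => ¬ i.val < s]
  exact ⟨fun h i j hij hi => h i j hij (not_lt.2 hi) (not_lt.2 (hi.trans hij.le)),
    fun h i j hij hi _ => h i j hij (not_lt.1 hi)⟩

theorem shuffleSum_eq_sum_perm {r : ℕ} (s : ℕ) (x : Fin r → V) (F : List V → K) :
    shuffleSum F ((List.ofFn x).take s) ((List.ofFn x).drop s) =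
      ∑ σ : Equiv.Perm (Fin r) with
        (∀ i j : Fin r, i < j → j.val < s → σ i < σ j) ∧
        (∀ i j : Fin r, i < j → s ≤ i.val → σ i < σ j),
      F (List.ofFn fun i => x (σ.symm i)) := by
  have map_symm : ∀ σ : Equiv.Perm (Fin r),
      F ((List.ofFn σ.symm).map x) = F (List.ofFn fun i => x (σ.symm i)) := by
    intro σ
    rw [List.map_ofFn]
    rfl
  rw [List.ofFn_eq_map, ← List.map_take, ← List.map_drop, shuffleSum_map, Finset.sum_filter]
  rw [shuffleSum_congr fun v hv => apply_eq_sum_perm (hv.trans (by rw [List.take_append_drop]))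
    fun w => F (w.map x), shuffleSum_sum]
  refine Finset.sum_congr rfl fun σ _ => ?_
  rw [map_symm, shuffleSum_ite_eq (fun i : Fin r => i.val < s) _ _ _ _
    (fun _ => mem_take_finRange.1) (fun _ => mem_drop_finRange.1)]
  exact if_congr (and_congr (filter_lt_ofFn_symm_iff s σ) (filter_not_lt_ofFn_symm_iff s σ)) rfl rfl

end Permutations

section SumsOverIndices

variable {V K : Type*} [AddCommMonoid K]

theorem splitSum_splitSum_eq_sum (F : List V → List V → List V → K) (w : List V) :
    splitSum (fun a t => splitSum (fun b c => F a b c) t) w =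
      ∑ k ∈ Finset.range (w.length + 1), ∑ l ∈ Finset.Icc k w.length,
        F (w.take k) ((w.take l).drop k) (w.drop l) := by
  rw [splitSum_eq_sum_range]
  refine Finset.sum_congr rfl fun k hk => ?_
  have k_le : k ≤ w.length := Nat.lt_succ_iff.1 (Finset.mem_range.1 hk)
  rw [splitSum_eq_sum_range, List.length_drop, ← Finset.Ico_succ_right_eq_Icc,
    Finset.sum_Ico_eq_sum_range, Order.succ_eq_add_one, Nat.sub_add_comm k_le]
  refine Finset.sum_congr rfl fun i _ => ?_
  rw [List.drop_drop, List.drop_take, Nat.add_sub_cancel_left]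

theorem splitSum_splitSum_eq_sum_Ioo {F : List V → List V → List V → K}
    (hb : ∀ a c, F a [] c = 0) (hc : ∀ a b, F a b [] = 0) (w : List V) :
    splitSum (fun a t => splitSum (fun b c => F a b c) t) w =
      ∑ k ∈ Finset.range w.length, ∑ l ∈ Finset.Ioo k w.length,
        F (w.take k) ((w.take l).drop k) (w.drop l) := by
  have sum_last : ∑ l ∈ Finset.Icc w.length w.length,
      F (w.take w.length) ((w.take l).drop w.length) (w.drop l) = 0 := by
    simp [hb]
  rw [splitSum_splitSum_eq_sum, Finset.sum_range_succ, sum_last, add_zero]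
  refine Finset.sum_congr rfl fun k _ => (Finset.sum_subset Finset.Ioo_subset_Icc_self ?_).symm
  intro l hl hl'
  rw [Finset.mem_Icc] at hl
  rw [Finset.mem_Ioo] at hl'
  obtain rfl | rfl : l = k ∨ l = w.length := by omega
  · rw [List.drop_take_self, hb]
  · rw [List.drop_length, hc]

theorem splitSum_splitSum_eq_sum_Ioc {F : List V → List V → List V → K}
    (ha : ∀ b c, F [] b c = 0) (hb : ∀ a c, F a [] c = 0) (w : List V) :
    splitSum (fun a t => splitSum (fun b c => F a b c) t) w =
      ∑ k ∈ Finset.Icc 1 w.length, ∑ l ∈ Finset.Ioc k w.length,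
        F (w.take k) ((w.take l).drop k) (w.drop l) := by
  have sum_zero : ∑ l ∈ Finset.Icc 0 w.length,
      F (w.take 0) ((w.take l).drop 0) (w.drop l) = 0 := by
    simp [ha]
  rw [splitSum_splitSum_eq_sum, Finset.range_eq_Ico,
    Finset.sum_eq_sum_Ico_succ_bot (Nat.succ_pos _), sum_zero, zero_add, zero_add,
    show Finset.Ico 1 w.length.succ = Finset.Icc 1 w.length from Finset.Ico_succ_right_eq_Icc _ _]
  refine Finset.sum_congr rfl fun k _ => (Finset.sum_subset Finset.Ioc_subset_Icc_self ?_).symm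
  intro l hl hl'
  rw [Finset.mem_Icc] at hl
  rw [Finset.mem_Ioc] at hl'
  obtain rfl : l = k := by omega
  rw [List.drop_take_self, hb]

end SumsOverIndices

section Flexions

variable {V K : Type*} [Field V] [CommRing K] {B : List V → K}

theorem absorbLeft_eq_sum_flexR (A : List V → K) (hB : B [] = 0) (w : List V) :
    absorbLeft (fun _ => B) (fun z b => z + b.sum) A w =
      ∑ k ∈ Finset.range w.length, ∑ l ∈ Finset.Ioo k w.length,
        A (Mould.flexR (w.take k) ((w.take l).drop k) (w.drop l)) * B ((w.take l).drop k) := by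
  have to_splitSum : absorbLeft (fun _ => B) (fun z b => z + b.sum) A w =
      splitSum (fun a t => splitSum (fun b c =>
        if c = [] then 0 else A (Mould.flexR a b c) * B b) t) w := by
    rw [← splitSum_assoc, splitSum_eq_nil_right_add]
    simp [absorbLeft, Mould.flexR, add_comm]
  rw [to_splitSum, splitSum_splitSum_eq_sum_Ioo (by simp [hB]) (by simp)]
  refine Finset.sum_congr rfl fun k _ => Finset.sum_congr rfl fun l hl => if_neg ?_
  rw [List.drop_eq_nil_iff, not_le]
  exact (Finset.mem_Ioo.1 hl).2

theorem absorbRight_eq_sum_flexL (A : List V → K) (hB : B [] = 0) (w : List V) :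
    absorbRight (fun _ => B) (fun z b => z + b.sum) A w =
      ∑ k ∈ Finset.Icc 1 w.length, ∑ l ∈ Finset.Ioc k w.length,
        A (Mould.flexL (w.take k) ((w.take l).drop k) (w.drop l)) * B ((w.take l).drop k) := by
  have to_splitSum : absorbRight (fun _ => B) (fun z b => z + b.sum) A w =
      splitSum (fun a t => splitSum (fun b c =>
        if a = [] then 0 else A (Mould.flexL a b c) * B b) t) w := by
    rw [splitSum_eq_nil_left_add]
    simp only [absorbRight, Mould.flexL, if_true, splitSum_zero, zero_add,
      List.append_ne_nil_of_right_ne_nil _ (List.cons_ne_nil _ _), if_false,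
      List.dropLast_concat, List.getLastD_concat]
  rw [to_splitSum, splitSum_splitSum_eq_sum_Ioc (by simp) (by simp [hB])]
  refine Finset.sum_congr rfl fun k hk => Finset.sum_congr rfl fun l _ => if_neg ?_
  rw [List.take_eq_nil_iff, ← List.length_eq_zero_iff]
  have := Finset.mem_Icc.1 hk
  omega

theorem arit_eq_sum (A : List V → K) (hB : B [] = 0) (w : List V) :
    arit B A w =
      (∑ k ∈ Finset.range w.length, ∑ l ∈ Finset.Ioo k w.length,
        A (Mould.flexR (w.take k) ((w.take l).drop k) (w.drop l)) * B ((w.take l).drop k)) -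
      ∑ k ∈ Finset.Icc 1 w.length, ∑ l ∈ Finset.Ioc k w.length,
        A (Mould.flexL (w.take k) ((w.take l).drop k) (w.drop l)) * B ((w.take l).drop k) := by
  rw [arit_eq_absorb, absorb, Pi.sub_apply, absorbLeft_eq_sum_flexR A hB,
    absorbRight_eq_sum_flexL A hB]

end Flexions

theorem getElem_increments {V : Type*} [AddCommGroup V] (p : V) (w : List V) (i : ℕ)
    (h : i < w.length) :
    (increments p w)[i]'(by simpa using h) = w[i] - (p :: w)[i]'(by simp; omega) := by
  induction w generalizing p i with
  | nil => simp at h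
  | cons q w ih =>
    cases i with
    | zero => rfl
    | succ i => simpa using ih q i (by simpa using h)

end WordFun

namespace Mould

section Flexions

variable {K L : Type*} [Field K] [Field L]

theorem map_flexR (φ : K →+* L) (a b c : List K) :
    (flexR a b c).map φ = flexR (a.map φ) (b.map φ) (c.map φ) := by
  cases c <;> simp [flexR, map_list_sum]

theorem map_flexL (φ : K →+* L) (a b c : List K) :
    (flexL a b c).map φ = flexL (a.map φ) (b.map φ) (c.map φ) := by
  rcases List.eq_nil_or_concat a with rfl | ⟨a, z, rfl⟩
  · simp [flexL, map_list_sum]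
  · simp [flexL, map_list_sum]

end Flexions

/-! ### Moulds as functions on generic words -/

section EvaluationAtGenericWords

variable {K : Type*} [Field K] [Algebra ℚ K] {r : ℕ} {e : Fin r → K}
  (he : AlgebraicIndependent ℚ e) {w : List K} (hw : IsGeneric e w)

include he hw

theorem evalWord_eq_evalHom (A : Mould) :
    A.evalWord w = RatFun.evalHom (hw.algebraicIndependent he) (A w.length) :=
  (RatFun.evalHom_apply _ _).symm

theorem map_evalHom_vars :
    (vars w.length).map (RatFun.evalHom (hw.algebraicIndependent he)) = w := by
  rw [vars, List.map_ofFn]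
  conv_rhs => rw [← List.ofFn_get w]
  congr 1
  funext i
  exact RatFun.evalHom_var _ i

theorem evalWord_add (A B : Mould) : (A + B).evalWord w = A.evalWord w + B.evalWord w := by
  simp only [evalWord_eq_evalHom he hw, Pi.add_apply, map_add]

theorem evalWord_sub (A B : Mould) : (A - B).evalWord w = A.evalWord w - B.evalWord w := by
  simp only [evalWord_eq_evalHom he hw, Pi.sub_apply, map_sub]

theorem evalWord_smul (k : ℚ) (A : Mould) :
    (k • A).evalWord w = algebraMap ℚ K k * A.evalWord w := by
  simp only [evalWord_eq_evalHom he hw, Pi.smul_apply]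
  simpa using map_ratCast_smul (RatFun.evalHom (hw.algebraicIndependent he)) ℚ K k (A w.length)

theorem evalWord_mu (A B : Mould) :
    (mu A B).evalWord w = WordFun.mu A.evalWord B.evalWord w := by
  rw [evalWord_eq_evalHom he hw, mu, map_sum, WordFun.mu_apply, WordFun.splitSum_eq_sum_range]
  refine Finset.sum_congr rfl fun i _ => ?_
  rw [map_mul, map_evalWord, map_evalWord, List.map_take, List.map_drop, map_evalHom_vars he hw]

theorem evalWord_arit {A B : Mould} (hB : B ∈ ARI) :
    (arit B A).evalWord w = WordFun.arit B.evalWord A.evalWord w := by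
  have map_flexR' := map_flexR (RatFun.evalHom (hw.algebraicIndependent he)).toRingHom
  have map_flexL' := map_flexL (RatFun.evalHom (hw.algebraicIndependent he)).toRingHom
  simp only [AlgHom.toRingHom_eq_coe, RingHom.coe_coe] at map_flexR' map_flexL'
  simp only [evalWord_eq_evalHom he hw (arit B A), WordFun.arit_eq_sum _ (evalWord_nil hB), arit,
    map_sub, map_sum, map_mul, map_evalWord, map_flexR', map_flexL', List.map_take, List.map_drop,
    map_evalHom_vars he hw]

theorem evalWord_ari {A B : Mould} (hA : A ∈ ARI) (hB : B ∈ ARI) :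
    (ari A B).evalWord w = WordFun.ari A.evalWord B.evalWord w := by
  rw [ari, lu, evalWord_add he hw, evalWord_sub he hw, evalWord_sub he hw,
    evalWord_arit he hw hB, evalWord_arit he hw hA, evalWord_mu he hw, evalWord_mu he hw]
  rfl

theorem evalWord_swap (A : Mould) :
    (swap A).evalWord w = A.evalWord (WordFun.increments 0 w.reverse) := by
  rw [evalWord_eq_evalHom he hw, swap, ← evalWord_ofFn, map_evalWord, List.map_ofFn]
  congr 1
  refine List.ext_getElem (by simp) fun i hi _ => ?_
  rw [List.length_ofFn] at hi
  rw [WordFun.getElem_increments _ _ _ (by simpa using hi)]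
  rcases i with _ | i
  · simp [RatFun.evalHom_var, Fin.rev]
  · have index_pred : w.length - 1 - i = w.length - (i + 1) := by omega
    have index : w.length - 1 - (i + 1) = w.length - (i + 1 + 1) := by omega
    simp [RatFun.evalHom_var, Fin.rev, index_pred, index]

end EvaluationAtGenericWords

section Congruence

variable {K ι : Type*} [CommRing K] [Algebra ℚ K] {e : ι → K} {A B A' B' : List K → K}
  (hA : ∀ w, IsGeneric e w → A w = A' w) (hB : ∀ w, IsGeneric e w → B w = B' w)
  {w : List K} (hw : IsGeneric e w)

include hA hB hw

theorem mu_congr_of_isGeneric : WordFun.mu A B w = WordFun.mu A' B' w := by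
  refine WordFun.splitSum_congr fun a b h => ?_
  subst h
  rw [hA a (hw.sublist (List.sublist_append_left _ _)),
    hB b (hw.sublist (List.sublist_append_right _ _))]

theorem arit_congr_of_isGeneric : WordFun.arit B A w = WordFun.arit B' A' w := by
  rw [WordFun.arit_eq_absorb, WordFun.arit_eq_absorb]
  refine congrArg₂ (fun x y : K => x - y) ?_ ?_
  · refine WordFun.pivotSum_congr fun s z c hs => WordFun.splitSum_congr fun a b hab => ?_
    rw [hs, hab, List.append_assoc] at hw
    exact congrArg₂ (· * ·) (hA _ hw.absorbLeft) (hB b (hw.sublist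
      ((List.sublist_append_left _ _).trans (List.sublist_append_right _ _))))
  · refine WordFun.pivotSum_congr fun a z s hs => WordFun.splitSum_congr fun b c hbc => ?_
    rw [hs, hbc] at hw
    exact congrArg₂ (· * ·) (hA _ hw.absorbRight) (hB b (hw.sublist
      (((List.sublist_append_left _ _).trans (List.sublist_cons_self _ _)).trans
        (List.sublist_append_right _ _))))

theorem ari_congr_of_isGeneric : WordFun.ari A B w = WordFun.ari A' B' w := by
  simp only [WordFun.ari_eq, Pi.add_apply, Pi.sub_apply, arit_congr_of_isGeneric hA hB hw,
    arit_congr_of_isGeneric hB hA hw, mu_congr_of_isGeneric hA hB hw,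
    mu_congr_of_isGeneric hB hA hw]

end Congruence

theorem swap_mem_ARI {A : Mould} (hA : A ∈ ARI) : swap A ∈ ARI := by
  change RatFun.eval (A 0) _ = 0
  rw [← evalWord_ofFn]
  exact evalWord_nil hA

section GenericEvaluation

variable {K : Type*} [Field K] [Algebra ℚ K] {r : ℕ} {e : Fin r → K}

open Classical in
/-- The function on words that takes the values of the mould `A` at generic words, and vanishes
at all other words, where the values of `A` are meaningless. -/
noncomputable def genericEval (e : Fin r → K) (A : Mould) (w : List K) : K :=
  if IsGeneric e w then A.evalWord w else 0

theorem genericEval_of_isGeneric {w : List K} (hw : IsGeneric e w) (A : Mould) :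
    genericEval e A w = A.evalWord w := if_pos hw

theorem genericEval_of_not_isGeneric {w : List K} (hw : ¬ IsGeneric e w) (A : Mould) :
    genericEval e A w = 0 := if_neg hw

theorem genericEval_nil {A : Mould} (hA : A ∈ ARI) : genericEval e A [] = 0 := by
  rw [genericEval, evalWord_nil hA, ite_self]

theorem isAlternal_iff_shuffleSum {A : Mould} : A.IsAlternal ↔ ∀ r s : ℕ, 1 ≤ s → s < r →
    WordFun.shuffleSum A.evalWord ((vars r).take s) ((vars r).drop s) = 0 := by
  simp only [IsAlternal, vars, WordFun.shuffleSum_eq_sum_perm, evalWord_ofFn]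

variable (he : AlgebraicIndependent ℚ e)

include he

theorem genericEval_add (A B : Mould) :
    genericEval e (A + B) = genericEval e A + genericEval e B := by
  funext w
  by_cases hw : IsGeneric e w
  · simp only [Pi.add_apply, genericEval_of_isGeneric hw, evalWord_add he hw]
  · simp only [Pi.add_apply, genericEval_of_not_isGeneric hw, add_zero]

theorem genericEval_smul (k : ℚ) (A : Mould) :
    genericEval e (k • A) = algebraMap ℚ K k • genericEval e A := by
  funext w
  by_cases hw : IsGeneric e w
  · simp only [Pi.smul_apply, genericEval_of_isGeneric hw, evalWord_smul he hw, smul_eq_mul]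
  · simp only [Pi.smul_apply, genericEval_of_not_isGeneric hw, smul_zero]

theorem genericEval_ari {A B : Mould} (hA : A ∈ ARI) (hB : B ∈ ARI) {w : List K}
    (hw : IsGeneric e w) :
    genericEval e (ari A B) w = WordFun.ari (genericEval e A) (genericEval e B) w := by
  rw [genericEval_of_isGeneric hw, evalWord_ari he hw hA hB]
  exact ari_congr_of_isGeneric (fun w hw => (genericEval_of_isGeneric hw A).symm)
    (fun w hw => (genericEval_of_isGeneric hw B).symm) hw

theorem shuffleSum_evalWord_eq_zero {A : Mould} (hA : A.IsAlternal) {x y : List K} (hx : x ≠ [])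
    (hy : y ≠ []) (hxy : IsGeneric e (x ++ y)) : WordFun.shuffleSum A.evalWord x y = 0 := by
  let φ := RatFun.evalHom (hxy.algebraicIndependent he)
  have in_variables := isAlternal_iff_shuffleSum.1 hA (x ++ y).length x.length
    (List.length_pos_of_ne_nil hx) (by simpa using List.length_pos_of_ne_nil hy)
  calc WordFun.shuffleSum A.evalWord x y
    _ = WordFun.shuffleSum (fun w => A.evalWord (w.map φ)) ((vars (x ++ y).length).take x.length)
          ((vars (x ++ y).length).drop x.length) := by
      rw [← WordFun.shuffleSum_map, List.map_take, List.map_drop, map_evalHom_vars he hxy,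
        List.take_left, List.drop_left]
    _ = φ (WordFun.shuffleSum A.evalWord ((vars (x ++ y).length).take x.length)
          ((vars (x ++ y).length).drop x.length)) := by
      simp only [← map_evalWord]
      exact (WordFun.map_shuffleSum φ.toLinearMap.toAddMonoidHom _ _ _).symm
    _ = 0 := by rw [in_variables, map_zero]

theorem IsAlternal.genericEval {A : Mould} (hA : A ∈ ARI) (hal : A.IsAlternal) :
    WordFun.IsAlternal (genericEval e A) := by
  refine ⟨genericEval_nil hA, fun x y hx hy => ?_⟩
  by_cases hw : IsGeneric e (x ++ y)
  · rw [← shuffleSum_evalWord_eq_zero he hal hx hy hw]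
    exact WordFun.shuffleSum_congr fun w hp => genericEval_of_isGeneric (hw.perm hp) A
  · rw [← WordFun.shuffleSum_zero (K := K) x y]
    exact WordFun.shuffleSum_congr fun w hp =>
      genericEval_of_not_isGeneric (fun h => hw (h.perm hp.symm)) A

theorem genericEval_increments_eq_swap (A : Mould) (p : K) (w : List K) :
    Mould.genericEval e A (WordFun.increments p w) =
      Mould.genericEval e (swap A) (w.map (· - p)).reverse := by
  rw [← WordFun.increments_map_sub p p, sub_self]
  generalize w.map (· - p) = v
  by_cases hv : IsGeneric e v
  · have hv' := hv.perm v.reverse_perm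
    rw [genericEval_of_isGeneric (isGeneric_increments_iff.2 hv), genericEval_of_isGeneric hv',
      evalWord_swap he hv', List.reverse_reverse]
  · rw [genericEval_of_not_isGeneric (isGeneric_increments_iff.not.2 hv),
      genericEval_of_not_isGeneric fun h => hv (h.perm v.reverse_perm.symm)]

theorem IsAlternal.genericEval_increments {A : Mould} (hA : A ∈ ARI) (hal : (swap A).IsAlternal)
    (p : K) : WordFun.IsAlternal fun w => Mould.genericEval e A (WordFun.increments p w) := by
  simp only [genericEval_increments_eq_swap he]
  exact ((hal.genericEval he (swap_mem_ARI hA)).comp_reverse).comp_map (· - p)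

theorem genericEval_neg_singleton {A : Mould} (heven : RatFun.eval (A 1) (fun i => -var i) = A 1)
    (z : K) : genericEval e A [-z] = genericEval e A [z] := by
  by_cases hz : IsGeneric e [z]
  · rw [genericEval_of_isGeneric hz, genericEval_of_isGeneric hz.neg_cons,
      evalWord_eq_evalHom he hz]
    change _ = RatFun.evalHom _ (A 1)
    rw [← heven, RatFun.map_eval, ← evalWord_ofFn]
    simp only [map_neg, RatFun.evalHom_var]
    rfl
  · rw [genericEval_of_not_isGeneric hz, genericEval_of_not_isGeneric]
    exact fun h => hz (neg_neg z ▸ h.neg_cons)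

theorem isPushInvariant_genericEval {A : Mould} (hA : A ∈ ARIalal) :
    WordFun.IsPushInvariant (genericEval e A) :=
  have := IsAddTorsionFree.of_module_rat K
  (hA.2.1.genericEval he hA.1).isPushInvariant (hA.2.2.1.genericEval_increments he hA.1)
    (genericEval_neg_singleton he hA.2.2.2)

end GenericEvaluation

section Closure

theorem evalWord_vars (A : Mould) (r : ℕ) : A.evalWord (vars r) = A r := by
  have aeval_var : ∀ p : MvPolynomial (Fin r) ℚ, MvPolynomial.aeval var p =
      algebraMap (MvPolynomial (Fin r) ℚ) (RatFun r) p := by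
    intro p
    have := MvPolynomial.aeval_algebraMap_apply (RatFun r) (MvPolynomial.X (R := ℚ)) p
    rwa [MvPolynomial.aeval_X_left_apply] at this
  rw [vars, evalWord_ofFn, RatFun.eval, aeval_var, aeval_var]
  exact IsFractionRing.mk'_num_den' (MvPolynomial (Fin r) ℚ) (A r)

theorem ari_apply {A B : Mould} (hA : A ∈ ARI) (hB : B ∈ ARI) (r : ℕ) :
    ari A B r = WordFun.ari (genericEval var A) (genericEval var B) (vars r) := by
  rw [← genericEval_ari algebraicIndependent_var hA hB isGeneric_vars,
    genericEval_of_isGeneric isGeneric_vars, evalWord_vars]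

theorem ari_mem_ARI {A B : Mould} (hA : A ∈ ARI) (hB : B ∈ ARI) : ari A B ∈ ARI := by
  change ari A B 0 = 0
  rw [ari_apply hA hB]
  exact WordFun.ari_nil (genericEval_nil hA)

theorem IsAlternal.of_evalWord_eq {A : Mould} {F : ∀ r, List (RatFun r) → RatFun r}
    (hF : ∀ r, WordFun.IsAlternal (F r))
    (heq : ∀ r w, IsGeneric (var (r := r)) w → A.evalWord w = F r w) : A.IsAlternal := by
  refine isAlternal_iff_shuffleSum.2 fun r s hs hsr => ?_
  rw [WordFun.shuffleSum_congr (G := F r) fun w hw => heq r w (isGeneric_vars.perm ?_)]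
  · exact (hF r).shuffleSum_eq_zero _ _ (List.ne_nil_of_length_pos (by simp [vars]; omega))
      (List.ne_nil_of_length_pos (by simp [vars]; omega))
  · rwa [List.take_append_drop] at hw

theorem mem_ARIalal_of_evalWord_eq {A : Mould} {F : ∀ r, List (RatFun r) → RatFun r}
    (hA : A ∈ ARI) (heq : ∀ r w, IsGeneric (var (r := r)) w → A.evalWord w = F r w)
    (hF : ∀ r, WordFun.IsAlternal (F r))
    (hF' : ∀ r, WordFun.IsAlternal fun w => F r (WordFun.increments 0 w))
    (heven : F 1 [-var 0] = F 1 [var 0]) : A ∈ ARIalal := by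
  have hvar : IsGeneric var [var (r := 1) 0] := isGeneric_vars
  refine ⟨hA, .of_evalWord_eq hF heq, .of_evalWord_eq (fun r => (hF' r).comp_reverse)
    fun r w hw => ?_, ?_⟩
  · rw [evalWord_swap algebraicIndependent_var hw,
      heq r _ (isGeneric_increments_iff.2 (hw.perm w.reverse_perm))]
  · rw [← heq 1 _ hvar.neg_cons, ← heq 1 _ hvar] at heven
    rw [← evalWord_ofFn]
    exact heven.trans (evalWord_vars A 1)

theorem ari_mem_ARIalal {A B : Mould} (hA : A ∈ ARIalal) (hB : B ∈ ARIalal) :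
    ari A B ∈ ARIalal := by
  have he (r : ℕ) : AlgebraicIndependent ℚ (var (r := r)) := algebraicIndependent_var
  refine mem_ARIalal_of_evalWord_eq (ari_mem_ARI hA.1 hB.1)
    (F := fun r => WordFun.ari (genericEval var A) (genericEval var B)) (fun r w hw => ?_)
    (fun r => (hA.2.1.genericEval (he r) hA.1).ari (hB.2.1.genericEval (he r) hB.1))
    (fun r => WordFun.IsAlternal.ari_increments (genericEval_nil hA.1) (genericEval_nil hB.1)
      (hA.2.2.1.genericEval_increments (he r) hA.1) (hB.2.2.1.genericEval_increments (he r) hB.1)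
      (isPushInvariant_genericEval (he r) hA) (isPushInvariant_genericEval (he r) hB) 0) ?_
  · rw [← genericEval_ari (he r) hA.1 hB.1 hw, genericEval_of_isGeneric hw]
  · simp only [WordFun.ari_singleton (genericEval_nil hA.1) (genericEval_nil hB.1)]

end Closure

end Mould

namespace WordFun

/-! ### Poles -/

section Poles

theorem absorb_fst {V K : Type*} [CommRing K] (A B : List V → K) :
    absorb (fun _ => B) (fun z _ => z) A = mu B A - mu A B := by
  funext w
  have left : splitSum (fun a t => splitSum (fun b c => A (a ++ c) * B b) t) w =
      mu A B w + absorbLeft (fun _ => B) (fun z _ => z) A w := by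
    rw [← splitSum_assoc, splitSum_eq_nil_right_add]
    simp only [List.append_nil, mu_apply, absorbLeft]
  have right : splitSum (fun a t => splitSum (fun b c => A (a ++ c) * B b) t) w =
      mu B A w + absorbRight (fun _ => B) (fun z _ => z) A w := by
    rw [splitSum_eq_nil_left_add]
    simp only [List.nil_append, List.append_assoc, List.singleton_append, mu_apply, absorbRight,
      mul_comm (B _)]
  simp only [absorb, Pi.sub_apply]
  linear_combination right - left

theorem splitSum_mem {V M σ : Type*} [AddCommMonoid M] [SetLike σ M] [AddSubmonoidClass σ M]
    {S : σ} {F : List V → List V → M} {w : List V} (h : ∀ a b, w = a ++ b → F a b ∈ S) :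
    splitSum F w ∈ S := by
  rw [splitSum_eq_sum_range]
  exact sum_mem fun i _ => h _ _ (List.take_append_drop i w).symm

theorem pivotSum_mem {V M σ : Type*} [AddCommMonoid M] [SetLike σ M] [AddSubmonoidClass σ M]
    {S : σ} {F : List V → V → List V → M} {w : List V}
    (h : ∀ a z c, w = a ++ z :: c → F a z c ∈ S) : pivotSum F w ∈ S := by
  induction w generalizing F with
  | nil => exact zero_mem S
  | cons z w ih =>
    rw [pivotSum_cons]
    exact add_mem (h [] z w rfl) (ih fun a y c hw => h (z :: a) y c (hw ▸ rfl))

variable {K : Type*} [Field K]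

/-- The numerator of `A` over the denominator `u₁ ⋯ u_r (u₁ + ⋯ + u_r)`. -/
def numer (A : List K → K) (w : List K) : K := w.prod * w.sum * A w

theorem numer_apply (A : List K → K) (w : List K) : numer A w = w.prod * w.sum * A w := rfl

/-- The function `A` divided by the sum of the letters; by convention it is `0` at the words with
sum `0`, in particular at the empty word. -/
def divSum (A : List K → K) (w : List K) : K := A w / w.sum

/-- No nonempty factor of `w`, and more generally no nonempty sublist, has sum `0`. -/
def NoZeroSum (w : List K) : Prop := ∀ s : List K, s.Sublist w → s ≠ [] → s.sum ≠ 0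

variable {A B : List K → K} {w : List K}

theorem NoZeroSum.perm {w' : List K} (hw : NoZeroSum w) (h : w'.Perm w) : NoZeroSum w' := by
  intro s hs hne
  obtain ⟨s', hs', hs'w⟩ := hs.subperm.trans h.subperm
  rw [← hs'.sum_eq]
  exact hw s' hs'w fun h0 => hne (List.Perm.eq_nil (h0 ▸ hs'.symm))

theorem mul_absorbed (hB : B [] = 0) {a b c : List K} {z : K}
    (hw : NoZeroSum (a ++ (b ++ z :: c))) :
    (a ++ (b ++ z :: c)).prod * (a ++ (b ++ z :: c)).sum * (A (a ++ (z + b.sum) :: c) * B b) =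
      numer A (a ++ (z + b.sum) :: c) * divSum (numer B) b -
        numer A (a ++ (z + b.sum) :: c) * (numer B b * (z + b.sum)⁻¹) := by
  rcases eq_or_ne b [] with rfl | hb
  · simp [hB, divSum, numer]
  have b_sum_ne : b.sum ≠ 0 := hw b (by simp) hb
  have letter_ne : z + b.sum ≠ 0 := by
    have := hw (b ++ [z]) (by simp) (by simp)
    rwa [List.sum_append, List.sum_singleton, add_comm] at this
  simp only [divSum, numer, List.prod_append, List.sum_append, List.prod_cons, List.sum_cons]
  field_simp
  ring

theorem mul_arit (hB : B [] = 0) (hw : NoZeroSum w) :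
    w.prod * w.sum * arit B A w =
      arit (divSum (numer B)) (numer A) w - contract (divSum (flank (numer B))) (numer A) w := by
  have left : w.prod * w.sum * absorbLeft (fun _ => B) (fun z b => z + b.sum) A w =
      absorbLeft (fun _ => divSum (numer B)) (fun z b => z + b.sum) (numer A) w -
        absorbLeft (fun z b => numer B b * (z + b.sum)⁻¹) (fun z b => z + b.sum) (numer A) w := by
    simp only [absorbLeft, ← pivotSum_mul_left, ← splitSum_mul_left, ← pivotSum_sub,
      ← splitSum_sub]
    refine pivotSum_congr fun s z c hs => splitSum_congr fun a b hab => ?_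
    have hw_eq : w = a ++ (b ++ z :: c) := by rw [hs, hab, List.append_assoc]
    rw [hw_eq]
    exact mul_absorbed hB (hw_eq ▸ hw)
  have right : w.prod * w.sum * absorbRight (fun _ => B) (fun z b => z + b.sum) A w =
      absorbRight (fun _ => divSum (numer B)) (fun z b => z + b.sum) (numer A) w -
        absorbRight (fun z b => numer B b * (z + b.sum)⁻¹) (fun z b => z + b.sum) (numer A) w := by
    simp only [absorbRight, ← pivotSum_mul_left, ← splitSum_mul_left, ← pivotSum_sub,
      ← splitSum_sub]
    refine pivotSum_congr fun a z s hs => splitSum_congr fun b c hbc => ?_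
    have hp : (a ++ (b ++ z :: c)).Perm w := by
      rw [hs, hbc]
      exact List.perm_middle.append_left a
    rw [← hp.prod_eq, ← hp.sum_eq]
    exact mul_absorbed hB (hw.perm hp)
  have poles_at_letters : absorb (fun z b => numer B b * (z + b.sum)⁻¹) (fun z b => z + b.sum)
      (numer A) w = contract (divSum (flank (numer B))) (numer A) w := by
    rw [absorb_eq_contract (by simp [numer]) (·⁻¹)]
    simp only [← div_eq_mul_inv]
    rfl
  simp only [absorb, Pi.sub_apply, arit_eq_absorb] at poles_at_letters ⊢
  linear_combination left - right - poles_at_letters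

theorem mul_mu (hA : A [] = 0) (hB : B [] = 0) (hw : NoZeroSum w) :
    w.prod * w.sum * mu A B w =
      mu (numer A) (divSum (numer B)) w + mu (divSum (numer A)) (numer B) w := by
  simp only [mu_apply, ← splitSum_mul_left, ← splitSum_add]
  refine splitSum_congr fun a b hab => ?_
  subst hab
  rcases eq_or_ne a [] with rfl | ha
  · simp [hA, divSum, numer]
  rcases eq_or_ne b [] with rfl | hb
  · simp [hB, divSum, numer]
  have a_sum_ne := hw a (List.sublist_append_left a b) ha
  have b_sum_ne := hw b (List.sublist_append_right a b) hb
  simp only [divSum, numer, List.prod_append, List.sum_append]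
  field_simp

/-- The part of the numerator of `ari A B` that has possible poles along the sums of the factors
on which `B` is evaluated, in terms of the numerators `P` and `Q` of `A` and `B`. -/
def factorPoles (P Q : List K → K) : List K → K :=
  absorb (fun _ => divSum Q) (fun z b => z + b.sum) P - absorb (fun _ => divSum Q) (fun z _ => z) P

theorem numer_ari (hA : A [] = 0) (hB : B [] = 0) (hw : NoZeroSum w) :
    numer (ari A B) w =
      factorPoles (numer A) (numer B) w - contract (divSum (flank (numer B))) (numer A) w -
        (factorPoles (numer B) (numer A) w -
          contract (divSum (flank (numer A))) (numer B) w) := by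
  rw [numer_apply, ari_eq]
  simp only [factorPoles, absorb_fst, Pi.add_apply, Pi.sub_apply, ← arit_eq_absorb]
  linear_combination mul_arit (A := A) hB hw - mul_arit (A := B) hA hw + mul_mu hA hB hw
    - mul_mu hB hA hw

theorem factorPoles_mem {S : Subring K} {P Q : List K → K} {w : List K}
    (hP : ∀ a b c z, w.Perm (a ++ (b ++ z :: c)) →
      (P (a ++ (z + b.sum) :: c) - P (a ++ z :: c)) / b.sum ∈ S)
    (hQ : ∀ b, b.Sublist w → Q b ∈ S) : factorPoles P Q w ∈ S := by
  have term_mem : ∀ a b c z, w.Perm (a ++ (b ++ z :: c)) → b.Sublist w →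
      P (a ++ (z + b.sum) :: c) * divSum Q b - P (a ++ z :: c) * divSum Q b ∈ S := by
    intro a b c z hp hb
    rw [← sub_mul, divSum, mul_div_left_comm, mul_comm]
    exact mul_mem (hP a b c z hp) (hQ b hb)
  rw [factorPoles, absorb, absorb, sub_sub_sub_comm]
  simp only [Pi.sub_apply, absorbLeft, absorbRight]
  rw [← pivotSum_sub, ← pivotSum_sub]
  simp only [← splitSum_sub]
  refine sub_mem (pivotSum_mem fun s z c hs => splitSum_mem fun a b hab =>
      term_mem a b c z ?_ ?_)
    (pivotSum_mem fun a z s hs => splitSum_mem fun b c hbc =>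
      term_mem a b c z ?_ ?_)
  · rw [hs, hab, List.append_assoc]
  · rw [hs, hab]
    exact (List.sublist_append_right a b).trans (List.sublist_append_left _ _)
  · rw [hs, hbc]
    exact List.perm_middle.symm.append_left a
  · rw [hs, hbc]
    exact ((List.sublist_append_left b c).cons z).trans (List.sublist_append_right a _)

theorem contract_divSum_mem {S : Subring K} {P Q : List K → K} {w : List K}
    (hP : ∀ a f c, w = a ++ (f ++ c) → f ≠ [] → P (a ++ f.sum :: c) ∈ S)
    (hQ : ∀ f, f.Sublist w → divSum Q f ∈ S) : contract (divSum Q) P w ∈ S := by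
  rw [contract_apply]
  refine splitSum_mem fun a t ht => splitSum_mem fun f c hfc => ?_
  subst hfc
  rcases eq_or_ne f [] with rfl | hf
  · simp [divSum]
  · refine mul_mem (hP a f c ht hf) (hQ f ?_)
    rw [ht]
    exact (List.sublist_append_left f c).trans (List.sublist_append_right a _)

end Poles

section Push

variable {K : Type*} [Field K] {A : List K → K}

theorem IsPushInvariant.apply_concat (hA : IsPushInvariant A) (w : List K) (y : K) :
    A (w ++ [y]) = A (-(w.sum + y) :: w) := by
  obtain ⟨v, rfl⟩ := increments_surjective 0 w
  have push := hA 0 v (v.getLastD 0 + y)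
  rw [increments_append, increments_cons, increments_nil, increments_cons,
    add_sub_cancel_left] at push
  rw [push, sum_increments, sub_zero, zero_sub]

theorem IsPushInvariant.numer_concat (hA : IsPushInvariant A) (w : List K) (y : K) :
    numer A (w ++ [y]) = numer A (-(w.sum + y) :: w) := by
  rw [numer_apply, numer_apply, hA.apply_concat, List.prod_append, List.sum_append,
    List.prod_singleton, List.sum_singleton, List.prod_cons, List.sum_cons]
  ring

end Push

end WordFun

namespace Mould

section PolynomialFamilies

variable {R S : Type*} [CommRing R] [Algebra ℚ R] [CommRing S] [Algebra ℚ S]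

/-- The value at a word of a family of polynomials, one for each number of variables. -/
noncomputable def polyWord (P : (n : ℕ) → MvPolynomial (Fin n) ℚ) (w : List R) : R :=
  MvPolynomial.aeval w.get (P w.length)

theorem map_polyWord (φ : R →ₐ[ℚ] S) (P : (n : ℕ) → MvPolynomial (Fin n) ℚ) (w : List R) :
    φ (polyWord P w) = polyWord P (w.map φ) := by
  have aeval_get_cast : ∀ (n : ℕ) (v : List S) (h : v.length = n),
      MvPolynomial.aeval (fun i => v.get (i.cast h.symm)) (P n) = polyWord P v := by
    rintro n v rfl
    rfl
  rw [← aeval_get_cast w.length (w.map φ) (List.length_map φ), polyWord,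
    MvPolynomial.comp_aeval_apply]
  simp

theorem dvd_polyWord_sub (P : (n : ℕ) → MvPolynomial (Fin n) ℚ) (a c : List R) (y z : R) :
    y ∣ polyWord P (a ++ (z + y) :: c) - polyWord P (a ++ z :: c) := by
  rw [← Ideal.mem_span_singleton, ← Ideal.Quotient.mk_eq_mk_iff_sub_mem,
    ← Ideal.Quotient.mkₐ_eq_mk ℚ, map_polyWord, map_polyWord]
  have letter_eq : Ideal.Quotient.mkₐ ℚ (Ideal.span {y}) (z + y) =
      Ideal.Quotient.mkₐ ℚ (Ideal.span {y}) z := by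
    rw [Ideal.Quotient.mkₐ_eq_mk, Ideal.Quotient.mk_eq_mk_iff_sub_mem, add_sub_cancel_left]
    exact Ideal.mem_span_singleton_self y
  simp only [List.map_append, List.map_cons, letter_eq]

variable {K : Type*} [Field K] [Algebra ℚ K] {T : Subalgebra ℚ K}

theorem polyWord_mem (P : (n : ℕ) → MvPolynomial (Fin n) ℚ) {w : List K} (hw : ∀ z ∈ w, z ∈ T) :
    polyWord P w ∈ T := by
  lift w to List T using hw
  have := map_polyWord T.val P w
  exact this ▸ (polyWord P w).2

theorem polyWord_sub_div_mem (P : (n : ℕ) → MvPolynomial (Fin n) ℚ) {a c : List K} {y z : K}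
    (ha : ∀ x ∈ a, x ∈ T) (hc : ∀ x ∈ c, x ∈ T) (hy : y ∈ T) (hz : z ∈ T) :
    (polyWord P (a ++ (z + y) :: c) - polyWord P (a ++ z :: c)) / y ∈ T := by
  rcases eq_or_ne y 0 with rfl | y_ne
  · simp
  lift a to List T using ha
  lift c to List T using hc
  lift y to T using hy
  lift z to T using hz
  obtain ⟨q, hq⟩ := dvd_polyWord_sub P a c y z
  have hq' := congrArg T.val hq
  rw [map_sub, map_mul, map_polyWord, map_polyWord] at hq'
  simp only [List.map_append, List.map_cons, Subalgebra.coe_val, Subalgebra.coe_add] at hq'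
  rw [hq', mul_div_cancel_left₀ _ y_ne]
  exact q.2

end PolynomialFamilies

section Singularities

variable {K : Type*} [Field K] [Algebra ℚ K] {r : ℕ} {e : Fin r → K}

theorem IsGeneric.sum_ne_zero {w : List K} (hw : IsGeneric e w) (hne : w ≠ []) : w.sum ≠ 0 := by
  intro sum_eq_zero
  have relation : ∑ i : Fin w.length, (1 : ℚ) • w.get i = 0 := by
    simp only [one_smul]
    rw [← sum_eq_zero, ← List.sum_ofFn, List.ofFn_get]
  exact one_ne_zero (Fintype.linearIndependent_iff.1 hw.2 (fun _ => 1) relation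
    ⟨0, List.length_pos_of_ne_nil hne⟩)

theorem IsGeneric.noZeroSum {w : List K} (hw : IsGeneric e w) : WordFun.NoZeroSum w :=
  fun _ hs hne => (hw.sublist hs).sum_ne_zero hne

theorem IsGeneric.push {w : List K} {y : K} (h : IsGeneric e (w ++ [y])) :
    IsGeneric e (-(w.sum + y) :: w) := by
  have last_first : IsGeneric e (y :: w) := h.perm (List.perm_append_singleton y w).symm
  rw [add_comm]
  exact (last_first.add_sum_cons (List.Subset.refl w)).neg_cons

theorem numer_genericEval (he : AlgebraicIndependent ℚ e) {A : Mould}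
    {P : (n : ℕ) → MvPolynomial (Fin n) ℚ} (hP : ∀ n, Δ n * A n = algebraMap _ (RatFun n) (P n))
    {w : List K} (hw : IsGeneric e w) : WordFun.numer (genericEval e A) w = polyWord P w := by
  have Δ_eq : Δ w.length = (vars w.length).prod * (vars w.length).sum := by
    rw [Δ, vars, List.prod_ofFn, List.sum_ofFn]
  have eval_numer := congrArg (RatFun.evalHom (hw.algebraicIndependent he)) (hP w.length)
  rw [RatFun.evalHom_algebraMap, map_mul, ← evalWord_eq_evalHom he hw A, Δ_eq, map_mul,
    map_list_prod, map_list_sum, map_evalHom_vars he hw] at eval_numer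
  rw [WordFun.numer_apply, genericEval_of_isGeneric hw, eval_numer, polyWord]

theorem exists_numer_eq_polynomial {A : Mould} (hA : A ∈ ARIsing) :
    ∃ P : (n : ℕ) → MvPolynomial (Fin n) ℚ, ∀ n, Δ n * A n = algebraMap _ (RatFun n) (P n) := by
  have exists_polynomial : ∀ n, ∃ p : MvPolynomial (Fin n) ℚ,
      Δ n * A n = algebraMap _ (RatFun n) p
    | 0 => ⟨0, by simp [Δ]⟩
    | n + 1 => hA.2 (n + 1) (Nat.succ_pos n)
  choose P hP using exists_polynomial
  exact ⟨P, hP⟩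

section Membership

variable {T : Subalgebra ℚ K} (he : AlgebraicIndependent ℚ e) {A B : Mould} {w : List K}

include he

theorem numer_genericEval_mem (hA : A ∈ ARIsing) (hw : IsGeneric e w) (hT : ∀ z ∈ w, z ∈ T) :
    WordFun.numer (genericEval e A) w ∈ T := by
  obtain ⟨P, hP⟩ := exists_numer_eq_polynomial hA
  rw [numer_genericEval he hP hw]
  exact polyWord_mem P hT

theorem numer_genericEval_sub_div_mem (hA : A ∈ ARIsing) {a c : List K} {y z : K}
    (hyz : IsGeneric e (a ++ (z + y) :: c)) (hz : IsGeneric e (a ++ z :: c))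
    (hT : ∀ x ∈ a ++ z :: c, x ∈ T) (hyT : y ∈ T) :
    (WordFun.numer (genericEval e A) (a ++ (z + y) :: c) -
      WordFun.numer (genericEval e A) (a ++ z :: c)) / y ∈ T := by
  obtain ⟨P, hP⟩ := exists_numer_eq_polynomial hA
  rw [numer_genericEval he hP hyz, numer_genericEval he hP hz]
  simp only [List.forall_mem_append, List.forall_mem_cons] at hT
  exact polyWord_sub_div_mem P hT.1 hT.2.2 hyT hT.2.1

/-- Push-invariance moves both values of the flank to words that differ only in their first letter,
by the sum of `w`. -/
theorem divSum_flank_numer_mem (hA : A ∈ ARIalal) (hA' : A ∈ ARIsing) (hw : IsGeneric e w)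
    (hT : ∀ z ∈ w, z ∈ T) :
    WordFun.divSum (WordFun.flank (WordFun.numer (genericEval e A))) w ∈ T := by
  rcases w with _ | ⟨z, w⟩
  · simp [WordFun.divSum]
  rcases List.eq_nil_or_concat' w with rfl | ⟨m, y, rfl⟩
  · simp [WordFun.divSum, WordFun.flank]
  have push := (isPushInvariant_genericEval he hA).numer_concat m y
  have first_letter : -(m.sum + y) + (z :: (m ++ [y])).sum = z := by
    rw [List.sum_cons, List.sum_append, List.sum_singleton]
    ring
  have dropLast_generic : IsGeneric e (z :: m) := hw.sublist (by simp)
  have tail_generic : IsGeneric e (-(m.sum + y) :: m) := (hw.sublist (by simp)).push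
  have tail_mem : ∀ x ∈ -(m.sum + y) :: m, x ∈ T := by
    simp only [List.forall_mem_cons, List.forall_mem_append] at hT ⊢
    exact ⟨neg_mem (add_mem (list_sum_mem hT.2.1) hT.2.2.1), hT.2.1⟩
  have sub_div_mem := numer_genericEval_sub_div_mem he hA' (a := [])
    (first_letter.symm ▸ dropLast_generic) tail_generic tail_mem (list_sum_mem hT)
  rw [List.nil_append, List.nil_append, first_letter] at sub_div_mem
  rwa [WordFun.divSum, WordFun.flank, List.tail_cons, push, ← List.cons_append,
    List.dropLast_concat]

theorem factorPoles_sub_contract_mem (hA : A ∈ ARIsing) (hB : B ∈ ARIalal) (hB' : B ∈ ARIsing)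
    (hw : IsGeneric e w) (hT : ∀ z ∈ w, z ∈ T) :
    WordFun.factorPoles (WordFun.numer (genericEval e A)) (WordFun.numer (genericEval e B)) w -
      WordFun.contract (WordFun.divSum (WordFun.flank (WordFun.numer (genericEval e B))))
        (WordFun.numer (genericEval e A)) w ∈ T := by
  refine sub_mem (WordFun.factorPoles_mem (S := T.toSubring) (fun a b c z hp => ?_)
    fun b hb => ?_) (WordFun.contract_divSum_mem (S := T.toSubring) (fun a f c h hf => ?_)
      fun f hf => ?_)
  · have letters_mem : ∀ x ∈ a ++ (b ++ z :: c), x ∈ T := fun x hx => hT x (hp.mem_iff.2 hx)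
    have hw' := hw.perm hp.symm
    simp only [List.forall_mem_append, List.forall_mem_cons] at letters_mem
    refine numer_genericEval_sub_div_mem he hA hw'.absorbLeft (hw'.sublist (by simp)) ?_
      (list_sum_mem letters_mem.2.1)
    simpa only [List.forall_mem_append, List.forall_mem_cons] using ⟨letters_mem.1, letters_mem.2.2⟩
  · exact numer_genericEval_mem he hB' (hw.sublist hb) fun x hx => hT x (hb.subset hx)
  · obtain ⟨z, b, rfl⟩ := List.exists_cons_of_ne_nil hf
    subst h
    rw [List.sum_cons]
    refine numer_genericEval_mem he hA hw.absorbRight ?_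
    simp only [List.cons_append, List.forall_mem_append, List.forall_mem_cons] at hT ⊢
    exact ⟨hT.1, add_mem hT.2.1 (list_sum_mem hT.2.2.1), hT.2.2.2⟩
  · exact divSum_flank_numer_mem he hB hB' (hw.sublist hf) fun x hx => hT x (hf.subset hx)

theorem numer_ari_mem (hA : A ∈ ARIalal) (hB : B ∈ ARIalal) (hA' : A ∈ ARIsing)
    (hB' : B ∈ ARIsing) (hw : IsGeneric e w) (hT : ∀ z ∈ w, z ∈ T) :
    WordFun.numer (WordFun.ari (genericEval e A) (genericEval e B)) w ∈ T := by
  rw [WordFun.numer_ari (genericEval_nil hA.1) (genericEval_nil hB.1) hw.noZeroSum]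
  exact sub_mem (factorPoles_sub_contract_mem he hA' hB hB' hw hT)
    (factorPoles_sub_contract_mem he hB' hA hA' hw hT)

end Membership

theorem ari_mem_ARIsing {A B : Mould} (hA : A ∈ ARIalal) (hB : B ∈ ARIalal) (hA' : A ∈ ARIsing)
    (hB' : B ∈ ARIsing) : ari A B ∈ ARIsing := by
  refine ⟨ari_mem_ARI hA.1 hB.1, fun r _ => ?_⟩
  have letters_mem : ∀ z ∈ vars r,
      z ∈ (Algebra.algHom ℚ (MvPolynomial (Fin r) ℚ) (RatFun r)).range := by
    rw [vars, List.forall_mem_ofFn_iff]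
    exact fun i => ⟨MvPolynomial.X i, rfl⟩
  obtain ⟨p, hp⟩ := numer_ari_mem algebraicIndependent_var hA hB hA' hB' isGeneric_vars letters_mem
  refine ⟨p, ?_⟩
  rw [ari_apply hA.1 hB.1, Δ, ← List.prod_ofFn, ← List.sum_ofFn]
  exact hp.symm

end Singularities

theorem smul_apply_eq_mul (k : ℚ) (A : Mould) (r : ℕ) :
    (k • A) r = algebraMap ℚ (RatFun r) k * A r := by
  simpa only [evalWord_vars] using evalWord_smul algebraicIndependent_var isGeneric_vars k A

/-- The set `ARI` as a subspace of the space of moulds. -/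
def ariSubmodule : Submodule ℚ Mould where
  carrier := ARI
  zero_mem' := rfl
  add_mem' hA hB := (congrArg₂ (· + ·) hA hB).trans (add_zero 0)
  smul_mem' k A hA := by
    change (k • A) 0 = 0
    rw [smul_apply_eq_mul, show A 0 = 0 from hA, mul_zero]

/-! ### The Lie algebra -/

section Submodules

variable {A B : Mould}

theorem zero_mem_ARIalal : (0 : Mould) ∈ ARIalal := by
  refine mem_ARIalal_of_evalWord_eq ariSubmodule.zero_mem (F := fun _ => 0) (fun r w hw => ?_)
    (fun _ => .zero) (fun _ => .zero) rfl
  rw [evalWord_eq_evalHom algebraicIndependent_var hw, Pi.zero_apply, map_zero, Pi.zero_apply]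

theorem add_mem_ARIalal (hA : A ∈ ARIalal) (hB : B ∈ ARIalal) : A + B ∈ ARIalal := by
  have he (r : ℕ) : AlgebraicIndependent ℚ (var (r := r)) := algebraicIndependent_var
  refine mem_ARIalal_of_evalWord_eq (ariSubmodule.add_mem hA.1 hB.1)
    (F := fun r => genericEval var A + genericEval var B) (fun r w hw => ?_)
    (fun r => (hA.2.1.genericEval (he r) hA.1).add (hB.2.1.genericEval (he r) hB.1))
    (fun r => (hA.2.2.1.genericEval_increments (he r) hA.1 0).add
      (hB.2.2.1.genericEval_increments (he r) hB.1 0)) ?_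
  · rw [← genericEval_add (he r), genericEval_of_isGeneric hw]
  · simp only [Pi.add_apply, genericEval_neg_singleton (he 1) hA.2.2.2,
      genericEval_neg_singleton (he 1) hB.2.2.2]

theorem smul_mem_ARIalal (k : ℚ) (hA : A ∈ ARIalal) : k • A ∈ ARIalal := by
  have he (r : ℕ) : AlgebraicIndependent ℚ (var (r := r)) := algebraicIndependent_var
  refine mem_ARIalal_of_evalWord_eq (ariSubmodule.smul_mem k hA.1)
    (F := fun r => algebraMap ℚ (RatFun r) k • genericEval var A) (fun r w hw => ?_)
    (fun r => (hA.2.1.genericEval (he r) hA.1).smul _)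
    (fun r => (hA.2.2.1.genericEval_increments (he r) hA.1 0).smul _) ?_
  · rw [← genericEval_smul (he r), genericEval_of_isGeneric hw]
  · simp only [Pi.smul_apply, genericEval_neg_singleton (he 1) hA.2.2.2]

theorem zero_mem_ARIsing : (0 : Mould) ∈ ARIsing :=
  ⟨ariSubmodule.zero_mem, fun r _ => ⟨0, by simp⟩⟩

theorem add_mem_ARIsing (hA : A ∈ ARIsing) (hB : B ∈ ARIsing) : A + B ∈ ARIsing := by
  refine ⟨ariSubmodule.add_mem hA.1 hB.1, fun r hr => ?_⟩
  obtain ⟨p, hp⟩ := hA.2 r hr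
  obtain ⟨q, hq⟩ := hB.2 r hr
  exact ⟨p + q, by rw [Pi.add_apply, mul_add, hp, hq, map_add]⟩

theorem smul_mem_ARIsing (k : ℚ) (hA : A ∈ ARIsing) : k • A ∈ ARIsing := by
  refine ⟨ariSubmodule.smul_mem k hA.1, fun r hr => ?_⟩
  obtain ⟨p, hp⟩ := hA.2 r hr
  refine ⟨algebraMap ℚ _ k * p, ?_⟩
  rw [smul_apply_eq_mul, mul_left_comm, hp, map_mul, ← IsScalarTower.algebraMap_apply]

end Submodules

section LieAlgebra

theorem ari_self {A : Mould} (hA : A ∈ ARI) : ari A A = 0 := by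
  funext r
  rw [ari_apply hA hA, WordFun.ari_self, Pi.zero_apply, Pi.zero_apply]

theorem ari_jacobi {A B C : Mould} (hA : A ∈ ARI) (hB : B ∈ ARI) (hC : C ∈ ARI) :
    ari A (ari B C) = ari (ari A B) C + ari B (ari A C) := by
  funext r
  have he : AlgebraicIndependent ℚ (var (r := r)) := algebraicIndependent_var
  rw [Pi.add_apply, ari_apply hA (ari_mem_ARI hB hC), ari_apply (ari_mem_ARI hA hB) hC,
    ari_apply hB (ari_mem_ARI hA hC),
    ari_congr_of_isGeneric (fun _ _ => rfl) (fun _ => genericEval_ari he hB hC) isGeneric_vars,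
    ari_congr_of_isGeneric (fun _ => genericEval_ari he hA hB) (fun _ _ => rfl) isGeneric_vars,
    ari_congr_of_isGeneric (fun _ _ => rfl) (fun _ => genericEval_ari he hA hC) isGeneric_vars,
    WordFun.ari_jacobi (genericEval_nil hA) (genericEval_nil hB) (genericEval_nil hC),
    Pi.add_apply]

noncomputable instance : Bracket ariSubmodule ariSubmodule where
  bracket A B := ⟨ari A B, ari_mem_ARI A.2 B.2⟩

theorem lie_apply (A B : ariSubmodule) (r : ℕ) : (⁅A, B⁆ : ariSubmodule).1 r =
    WordFun.ari (genericEval var A.1) (genericEval var B.1) (vars r) := ari_apply A.2 B.2 r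

noncomputable instance : LieRing ariSubmodule where
  add_lie A B C := Subtype.ext <| funext fun r => by
    simp only [Submodule.coe_add, Pi.add_apply, lie_apply,
      genericEval_add algebraicIndependent_var, map_add, LinearMap.add_apply]
  lie_add A B C := Subtype.ext <| funext fun r => by
    simp only [Submodule.coe_add, Pi.add_apply, lie_apply,
      genericEval_add algebraicIndependent_var, map_add]
  lie_self A := Subtype.ext (ari_self A.2)
  leibniz_lie A B C := Subtype.ext (ari_jacobi A.2 B.2 C.2)

noncomputable instance : LieAlgebra ℚ ariSubmodule where
  lie_smul k A B := Subtype.ext <| funext fun r => by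
    change _ = (k • (⁅A, B⁆ : ariSubmodule).1) r
    rw [smul_apply_eq_mul, lie_apply, lie_apply, Submodule.coe_smul,
      genericEval_smul algebraicIndependent_var, map_smul, Pi.smul_apply, smul_eq_mul]

/-- The Lie subalgebra of `ARI` formed by the bialternal moulds in `ARIalal` whose poles are
bounded by `Δ`. -/
def bialternalSing : LieSubalgebra ℚ ariSubmodule where
  carrier := {A | A.1 ∈ ARIalal ∩ ARIsing}
  zero_mem' := ⟨zero_mem_ARIalal, zero_mem_ARIsing⟩
  add_mem' hA hB := ⟨add_mem_ARIalal hA.1 hB.1, add_mem_ARIsing hA.2 hB.2⟩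
  smul_mem' k _ hA := ⟨smul_mem_ARIalal k hA.1, smul_mem_ARIsing k hA.2⟩
  lie_mem' hA hB := ⟨ari_mem_ARIalal hA.1 hB.1, ari_mem_ARIsing hA.1 hB.1 hA.2 hB.2⟩

end LieAlgebra

end Mould

theorem mainTheorem2 :
    (∀ A B : Mould, A ∈ Mould.ARIalal ∩ Mould.ARIsing → B ∈ Mould.ARIalal ∩ Mould.ARIsing →
      Mould.ari A B ∈ Mould.ARIalal ∩ Mould.ARIsing) ∧
    ∃ (L : Type) (_ : LieRing L) (_ : LieAlgebra ℚ L) (ι : L →ₗ[ℚ] Mould),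
      Function.Injective ι ∧ Set.range ι = Mould.ARIalal ∩ Mould.ARIsing ∧
      ∀ x y : L, ι ⁅x, y⁆ = Mould.ari (ι x) (ι y) := by
  refine ⟨fun A B hA hB => ⟨Mould.ari_mem_ARIalal hA.1 hB.1,
      Mould.ari_mem_ARIsing hA.1 hB.1 hA.2 hB.2⟩,
    Mould.bialternalSing, inferInstance, inferInstance,
    Mould.ariSubmodule.subtype ∘ₗ Mould.bialternalSing.toSubmodule.subtype,
    Subtype.val_injective.comp Subtype.val_injective, Set.ext fun A => ⟨?_, fun hA => ?_⟩,
    fun _ _ => rfl⟩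
  · rintro ⟨x, rfl⟩
    exact x.2
  · exact ⟨⟨⟨A, hA.1.1⟩, hA⟩, rfl⟩
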